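/- **Model.** Let $D$ be a probability distribution over $[N]=\{1,\dots,N\}$. A PCOND oracle for $D$ accepts a query set $S\subseteq[N]$ that is either $S=[N]$ (this is called sampling from $D$) or $S=\{i,j\}$ with $i\neq j$. If $D(S)>0$, it returns $i\in S$ with probability $D(i)/D(S)$, independently of everything else; if $D(S)=0$, it fails. A testing algorithm may be adaptive and randomized; an execution in which an oracle fails ends at once and counts as REJECT. Let $d_{\mathrm{TV}}(D_1,D_2)=\frac12\sum_{i\in[N]}|D_1(i)-D_2(i)|$. **Procedures.** The constants $c_1,\dots,c_5>0$ below are absolute. All samples are counted with multiplicity. *Compare*$_D(x,y,\eta,K,\delta)$: if $x=y$, return the ratio $1$. Otherwise query $\{x,y\}$ exactly $\lceil c_1K\log(1/\delta)/\eta^2\rceil$ times, and let $\hat\mu$ be the fraction of answers equal to $y$. If $\hat\mu<\frac23\cdot\frac1{K+1}$ return Low; else if $1-\hat\mu<\frac23\cdot\frac1{K+1}$ return High; else return $\rho=\hat\mu/(1-\hat\mu)$. (Low and High belong to no interval.) *Estimate-Neighborhood*$_D(x;\kappa,\beta,\eta,\delta)$: let $\theta=\kappa\eta\beta\delta/64$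 and choose $\alpha$ uniformly from $\{\kappa+i\theta: 0\le i<\lceil\kappa/\theta\rceil\}$. Draw a sample $S$ of size $\lceil c_2\log(1/\delta)/(\beta\eta^2)\rceil$ from $D$. For each distinct point $y$ of $S$, call Compare$_D(x,y,\theta/4,4,\delta/(4|S|))$. Return $(\hat w,\alpha)$, where $\hat w$ is the fraction of the $y\in S$ whose result lies in $[1/(1+\alpha+\theta/2),\,1+\alpha+\theta/2]$. **Algorithm PCOND-Test-Equality-Unknown** (input $N$, $0<\varepsilon\le1$; PCOND access to $D_1,D_2$). Let $\tilde\varepsilon=\varepsilon/100$ and $t=\left\lceil c_3\,\frac{\log(2N/\varepsilon)}{\varepsilon^2}\,\log\frac{2\log(2N/\varepsilon)}{\varepsilon}\right\rceil$. Draw a sample $r_1,\dots,r_t$ from $D_1$. For $j=1,\dots,t$: 1. Call Estimate-Neighborhood$_{D_1}$ on $r_j$ with $\kappa=\tilde\varepsilon$, $\eta=\tilde\varepsilon/8$, $\beta=\tilde\varepsilon/(2t)$, $\delta=1/(100t)$; let the output be $(\hat w^{(1)},\alpha)$, and let $\theta=\kappa\eta\beta\delta/64$. 2. Draw a sample $S_1$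 of size $s_1=\lceil c_4t/\varepsilon^2\rceil$ from $D_1$ and a sample $S_2$ of size $s_2=\lceil c_5t\log t/\varepsilon^3\rceil$ from $D_2$. 3. For each distinct point $i$ of $S_1\cup S_2$ and for $b=1,2$, call Compare$_{D_b}(r_j,i,\theta/4,4,1/(200t(s_1+s_2)))$; let the result be $\rho^{(b)}(i)$. Let $\hat w^{(2)}$ be the fraction of the $i\in S_2$ with $\rho^{(1)}(i)\in[1/(1+\alpha+\theta/2),\,1+\alpha+\theta/2]$. 4. REJECT if ($\hat w^{(1)}\le\frac34\frac{\tilde\varepsilon}t$ and $\hat w^{(2)}>\frac32\frac{\tilde\varepsilon}t$) or ($\hat w^{(1)}>\frac34\frac{\tilde\varepsilon}t$ and $\hat w^{(2)}/\hat w^{(1)}\notin[1-\tilde\varepsilon/2,\,1+\tilde\varepsilon/2]$). 5. REJECT if some $i\in S_1\cup S_2$ has $\rho^{(1)}(i)\in[1/(1+\alpha+\tilde\varepsilon/2),\,1+\alpha+\tilde\varepsilon/2]$ and $\rho^{(2)}(i)\notin[1/(1+\alpha+3\tilde\varepsilon/2),\,1+\alpha+3\tilde\varepsilon/2]$. If no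 $j$ led to REJECT, ACCEPT. **Theorem.** The absolute constants $c_1,\dots,c_5>0$ can be chosen such that the following holds. For all $N\ge1$, all $0<\varepsilon\le1$ and all distributions $D_1,D_2$ over $[N]$: if $D_1=D_2$, then the algorithm returns ACCEPT with probability at least $2/3$; if $d_{\mathrm{TV}}(D_1,D_2)\ge\varepsilon$, then it returns REJECT with probability at least $2/3$. Moreover, there are absolute constants $C$ and $k$ such that for all $N\ge2$ and $0<\varepsilon\le1$ the number of PCOND queries that the algorithm makes is always at most $$C\cdot\frac{\log^6N}{\varepsilon^{21}}\cdot\log^k\!\left(2+\frac{\log^6N}{\varepsilon^{21}}\right),$$ that is, $\tilde O(\log^6N/\varepsilon^{21})$. -/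

import Mathlib

open scoped ENNReal

/-! ### Conditional sampling oracles -/

/-- The query sets that a PCOND oracle accepts: the whole domain `[N]`, or a set `{i, j}` of
size two. The domain `[N]` is modelled by `Fin N`. -/
inductive PCondQuery (N : ℕ) : Type
  | whole : PCondQuery N
  | pair (i j : Fin N) (hij : i ≠ j) : PCondQuery N

/-- The query set `S ⊆ [N]` of a PCOND query. -/
def PCondQuery.toSet {N : ℕ} : PCondQuery N → Set (Fin N)
  | .whole => Set.univ
  | .pair i j _ => {i, j}

open Classical in
/-- The answer of the oracle `COND_D` on the query set `S`: if `D(S) > 0`, an element of `S`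
distributed according to the conditional distribution `D_S(i) = D(i) / D(S)`; if `D(S) = 0`,
the oracle fails (`none`). -/
noncomputable def condOracle {N : ℕ} (D : PMF (Fin N)) (S : Set (Fin N)) :
    PMF (Option (Fin N)) :=
  if h : ∃ i ∈ S, i ∈ D.support then (D.filter S h).map some else PMF.pure none

/-! ### Adaptive randomized algorithms with PCOND access to two distributions -/

/-- Adaptive randomized algorithms over the domain `[N]` with PCOND access to two distributions
(number `0` and number `1`) and output in `α`: either halt with an output, or query one of the
two oracles and continue depending on the answer, or draw an internal uniformly random element
of `{0, …, m}` and continue depending on it. -/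
inductive PCondAlg (N : ℕ) (α : Type) : Type
  | halt (a : α) : PCondAlg N α
  | query (o : Fin 2) (q : PCondQuery N) (next : Fin N → PCondAlg N α) : PCondAlg N α
  | random (m : ℕ) (next : Fin (m + 1) → PCondAlg N α) : PCondAlg N α

namespace PCondAlg

/-- Sequential composition. -/
def bind {N : ℕ} {α β : Type} : PCondAlg N α → (α → PCondAlg N β) → PCondAlg N β
  | halt a, f => f a
  | query o q next, f => query o q fun x => (next x).bind f
  | random m next, f => random m fun i => (next i).bind f

instance (N : ℕ) : Monad (PCondAlg N) where
  pure := halt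
  bind := bind

/-- The distribution of the result of an execution when the two oracles give access to `D 0` and
`D 1`. All oracle answers and all internal coins are independent. If an oracle fails, the
execution ends with the result `none`. -/
noncomputable def run {N : ℕ} {α : Type} (D : Fin 2 → PMF (Fin N)) :
    PCondAlg N α → PMF (Option α)
  | halt a => PMF.pure (some a)
  | query o q next =>
      (condOracle (D o) q.toSet).bind fun
        | none => PMF.pure none
        | some x => run D (next x)
  | random m next => (PMF.uniformOfFintype (Fin (m + 1))).bind fun i => run D (next i)

/-- The worst-case number of oracle queries, i.e. the maximum number of oracle queries along an
execution, over all answers of the oracles and all internal coins. -/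
def maxQueries {N : ℕ} {α : Type} : PCondAlg N α → ℕ
  | halt _ => 0
  | query _ _ next => 1 + Finset.univ.sup fun x => (next x).maxQueries
  | random _ next => Finset.univ.sup fun i => (next i).maxQueries

/-- Repeat an algorithm `n` times independently and collect the outputs. -/
def replicate {N : ℕ} {α : Type} : ℕ → PCondAlg N α → PCondAlg N (List α)
  | 0, _ => pure []
  | n + 1, p => do
      let a ← p
      let l ← replicate n p
      pure (a :: l)

/-- One query to oracle `o`. -/
def ask {N : ℕ} (o : Fin 2) (q : PCondQuery N) : PCondAlg N (Fin N) :=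
  query o q pure

/-- Draw `n` independent samples from distribution number `o`. -/
def samples {N : ℕ} (o : Fin 2) (n : ℕ) : PCondAlg N (List (Fin N)) :=
  replicate n (ask o .whole)

/-- Run `f y` once for every `y` in the list `l` and tabulate the outputs; outside of `l` the
table has the default value `d`. -/
def tabulate {N : ℕ} {α : Type} (d : α) (f : Fin N → PCondAlg N α) :
    List (Fin N) → PCondAlg N (Fin N → α)
  | [] => pure fun _ => d
  | y :: l => do
      let a ← f y
      let g ← tabulate d f l
      pure (Function.update g y a)

end PCondAlg

/-- The two possible outputs of a testing algorithm. -/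
inductive Verdict : Type
  | accept : Verdict
  | reject : Verdict
  deriving DecidableEq

/-- The distribution of the verdict of a testing algorithm run on `D₁`, `D₂`. An execution in
which an oracle fails counts as `reject`. -/
noncomputable def PCondAlg.verdict {N : ℕ} (D₁ D₂ : PMF (Fin N)) (T : PCondAlg N Verdict) :
    PMF Verdict :=
  (T.run ![D₁, D₂]).map fun r => r.getD .reject

/-- Total variation distance of two distributions over `[N]`. -/
noncomputable def pmfTVDist {N : ℕ} (D₁ D₂ : PMF (Fin N)) : ℝ :=
  (1 / 2) * ∑ i, |(D₁ i).toReal - (D₂ i).toReal|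

/-! ### The algorithm -/

/-- The constants hidden in the `Θ(·)` expressions for the sample sizes. -/
structure SampleConstants : Type where
  /-- number of queries in `pcondCompare` -/
  cmp : ℝ
  /-- sample size in `estimateNeighborhood` -/
  nbh : ℝ
  /-- size of the sample of representatives -/
  rep : ℝ
  /-- size of the sample from the first distribution, for each representative -/
  fst : ℝ
  /-- size of the sample from the second distribution, for each representative -/
  snd : ℝ

/-- All hidden constants are positive. -/
def SampleConstants.Pos (c : SampleConstants) : Prop :=
  0 < c.cmp ∧ 0 < c.nbh ∧ 0 < c.rep ∧ 0 < c.fst ∧ 0 < c.snd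

/-- Output of the procedure `pcondCompare`: `low`, `high` or a number `ρ`. -/
inductive CompareResult : Type
  | low : CompareResult
  | high : CompareResult
  | ratio (ρ : ℝ) : CompareResult

/-- The result is a number, and it lies in `[1 / (1 + γ), 1 + γ]`. -/
def CompareResult.Close (γ : ℝ) : CompareResult → Prop
  | low => False
  | high => False
  | ratio ρ => 1 / (1 + γ) ≤ ρ ∧ ρ ≤ 1 + γ

/-- The fraction of the entries of `S`, counted with multiplicity, that satisfy `P`. -/
noncomputable def sampleFraction {N : ℕ} (S : List (Fin N)) (P : Fin N → Prop) : ℝ :=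
  open Classical in (S.countP fun y => decide (P y) : ℝ) / (S.length : ℝ)

open Classical in
/-- The procedure Compare for distribution number `o`, the sets `{x}` and `{y}`, and parameters
`η`, `K`, `δ`: it estimates `D(y) / D(x)`. The ratio of a point to itself is `1`, and no query is
made for it. -/
noncomputable def pcondCompare {N : ℕ} (c : SampleConstants) (o : Fin 2) (x y : Fin N) (η K δ : ℝ) :
    PCondAlg N CompareResult :=
  if hxy : x = y then pure (.ratio 1)
  else do
    let A ← PCondAlg.replicate ⌈c.cmp * (K * Real.log (1 / δ) / η ^ 2)⌉₊
      (PCondAlg.ask o (.pair x y hxy))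
    let μ := sampleFraction A fun a => a = y
    pure <|
      if μ < 2 / 3 * (1 / (K + 1)) then .low
      else if 1 - μ < 2 / 3 * (1 / (K + 1)) then .high
      else .ratio (μ / (1 - μ))

/-- The procedure Estimate-Neighborhood for distribution number `o`, a point `x` and parameters
`κ`, `β`, `η`, `δ`. It draws `α` uniformly from the points `κ + i * θ` of `[κ, 2 * κ)`, and
returns an estimate of the weight of the `α`-neighborhood of `x`, together with `α`. -/
noncomputable def estimateNeighborhood {N : ℕ} (c : SampleConstants) (o : Fin 2) (x : Fin N)
    (κ β η δ : ℝ) : PCondAlg N (ℝ × ℝ) := do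
  let θ := κ * η * β * δ / 64
  let i ← PCondAlg.random (⌈κ / θ⌉₊ - 1) pure
  let α := κ + (i : ℕ) * θ
  let s := ⌈c.nbh * (Real.log (1 / δ) / (β * η ^ 2))⌉₊
  let S ← PCondAlg.samples o s
  let ρ ← PCondAlg.tabulate .low (fun y => pcondCompare c o x y (θ / 4) 4 (δ / (4 * s))) S.dedup
  pure (sampleFraction S fun y => (ρ y).Close (α + θ / 2), α)

/-- The size `t` of the sample of representatives, of order
`(log (N / ε) / ε²) * log (log (N / ε) / ε)`. The factors `2` keep the logarithms away from `0`
when `N` and `1 / ε` are small. -/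
noncomputable def repSize (c : SampleConstants) (N : ℕ) (ε : ℝ) : ℕ :=
  ⌈c.rep * (Real.log (2 * N / ε) / ε ^ 2 * Real.log (2 * Real.log (2 * N / ε) / ε))⌉₊

open Classical in
/-- The test that is made for one representative `r`, where `t` is the number of
representatives. -/
noncomputable def testRepresentative {N : ℕ} (c : SampleConstants) (ε : ℝ) (t : ℕ) (r : Fin N) :
    PCondAlg N Verdict := do
  let ε' := ε / 100
  let κ := ε'
  let η := ε' / 8
  let β := ε' / (2 * t)
  let δ := 1 / (100 * (t : ℝ))
  let (w₁, α) ← estimateNeighborhood c 0 r κ β η δ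
  let θ := κ * η * β * δ / 64
  let s₁ := ⌈c.fst * (t / ε ^ 2)⌉₊
  let s₂ := ⌈c.snd * (t * Real.log t / ε ^ 3)⌉₊
  let S₁ ← PCondAlg.samples 0 s₁
  let S₂ ← PCondAlg.samples 1 s₂
  let δ' := 1 / (200 * (t : ℝ) * (s₁ + s₂))
  let ρ ← PCondAlg.tabulate (.low, .low)
    (fun i => do
      let a ← pcondCompare c 0 r i (θ / 4) 4 δ'
      let b ← pcondCompare c 1 r i (θ / 4) 4 δ'
      pure (a, b))
    (S₁ ++ S₂).dedup
  let w₂ := sampleFraction S₂ fun i => (ρ i).1.Close (α + θ / 2)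
  pure <|
    if (w₁ ≤ 3 / 4 * (ε' / t) ∧ 3 / 2 * (ε' / t) < w₂) ∨
        (3 / 4 * (ε' / t) < w₁ ∧ w₂ / w₁ ∉ Set.Icc (1 - ε' / 2) (1 + ε' / 2)) then
      .reject
    else if ∃ i ∈ S₁ ++ S₂, (ρ i).1.Close (α + ε' / 2) ∧ ¬ (ρ i).2.Close (α + 3 * ε' / 2) then
      .reject
    else .accept

/-- Test the representatives in the list one after the other, and reject as soon as one of the
tests rejects. -/
noncomputable def testRepresentatives {N : ℕ} (c : SampleConstants) (ε : ℝ) (t : ℕ) :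
    List (Fin N) → PCondAlg N Verdict
  | [] => pure .accept
  | r :: R => do
      match ← testRepresentative c ε t r with
      | .reject => pure .reject
      | .accept => testRepresentatives c ε t R

/-- The algorithm PCOND-Test-Equality-Unknown with inputs `N` and `ε`. Distribution number `0` is
`D₁`, distribution number `1` is `D₂`. -/
noncomputable def pcondTestEqualityUnknown (c : SampleConstants) (N : ℕ) (ε : ℝ) :
    PCondAlg N Verdict := do
  let R ← PCondAlg.samples 0 (repSize c N ε)
  testRepresentatives c ε (repSize c N ε) R

/-! ### Expectations and error probabilities of algorithms -/

namespace PCondAlg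

variable {N : ℕ} {α β : Type}

/-! Write x = ε/100. The probability space is avoided: expectations are defined by recursion on the
algorithm tree, and a failed execution gets a prescribed value v. An error bound with v = 1 treats
failure as an error (needed for ACCEPT), one with v = 0 treats it as success (enough for REJECT).
Union bounds along `bind` then do all the probabilistic bookkeeping.

The analysis of one representative r rests on three facts. Chernoff bounds make sample fractions
accurate up to a small multiple of p + β, where p is the true mass. Each comparison is reliable up
to precision θ, so the counted fraction lies between the sample fractions of the exact neighborhoods
of radii α and α + θ. Since α is random, the shell between these two radii is light with high
probability (`err_random_shell_le`), so both ends of the sandwich estimate the same mass.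

If the distributions are equal, both weights computed for r estimate the same p, and closeness to r
under one copy transfers to the other with slack much larger than θ. Each representative therefore
rejects with probability at most 1/(3t) (`representativeVerdict_eq_accept`).

If the distance is at least 100x, the points with D₂(i) < (1 - 50x) D₁(i) have D₁-mass at least 50x.
Points of weight below x/N cost at most x, and the rest fall into b = O(log(N/x)/x) geometric
buckets, so some bucket carries deficit mass at least 48x/b (`exists_deficit_bucket`). With high
probability some representative r lies in it. Suppose its test accepted. The points near r under D₁
but not under D₂ would have escaped both samples, so they have mass at most τ = 48x²/b. On the
remaining neighborhood both distributions are nearly constant, and the weight test gives it almost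
as much D₂-mass as D₁-mass. Counting points shows that no x-near point there has a deficit
(`deficit_le_of_mass_le`). The deficit points of the bucket would then have mass at most τ, a
contradiction (`representativeVerdict_eq_reject`).

For the query count, t is of order log N/ε² up to logarithms, each representative compares about
t/ε³ points, and a comparison costs about 1/θ² with θ of order ε³/t². The product is of order t⁶/ε⁹,
that is, log⁶N/ε²¹. The calculus of `PolylogBound` tracks these exponents. -/

theorem bind_query (o : Fin 2) (q : PCondQuery N) (next : Fin N → PCondAlg N α)
    (f : α → PCondAlg N β) : (query o q next >>= f) = query o q fun x => next x >>= f := rfl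

theorem bind_random (m : ℕ) (next : Fin (m + 1) → PCondAlg N α)
    (f : α → PCondAlg N β) : (random m next >>= f) = random m fun x => next x >>= f := rfl

/-- The expectation of `f` of the output, where a failed execution has the value `v`. -/
noncomputable def expect (D : Fin 2 → PMF (Fin N)) (v : ℝ) (f : α → ℝ) : PCondAlg N α → ℝ
  | halt a => f a
  | query o q next => (condOracle (D o) q.toSet none).toReal * v +
      ∑ x, (condOracle (D o) q.toSet (some x)).toReal * expect D v f (next x)
  | random m next => (∑ i, expect D v f (next i)) / (m + 1)

/-- All outputs satisfy `P`, if only answers allowed by `ok` occur. -/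
def Post (ok : Fin 2 → Fin N → Prop) (P : α → Prop) : PCondAlg N α → Prop
  | halt a => P a
  | query o _ next => ∀ x, ok o x → Post ok P (next x)
  | random _ next => ∀ i, Post ok P (next i)

theorem Post.bind {ok : Fin 2 → Fin N → Prop} {P : α → Prop} {Q : β → Prop}
    {A : PCondAlg N α} {f : α → PCondAlg N β} (hA : A.Post ok P)
    (hf : ∀ a, P a → (f a).Post ok Q) : (A >>= f).Post ok Q := by
  induction A with
  | halt a => exact hf a hA
  | query o q next ih => exact fun x hx => ih x (hA x hx)
  | random m next ih => exact fun i => ih i (hA i)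

theorem Post.replicate {ok : Fin 2 → Fin N → Prop} {P : α → Prop}
    {A : PCondAlg N α} (hA : A.Post ok P) (n : ℕ) :
    (replicate n A).Post ok fun l => l.length = n ∧ ∀ a ∈ l, P a := by
  induction n with
  | zero => exact ⟨rfl, by simp⟩
  | succ n ih =>
    refine hA.bind fun a ha => ih.bind fun l hl => ?_
    refine ⟨by simp [hl.1], ?_⟩
    simp only [List.mem_cons, forall_eq_or_imp]
    exact ⟨ha, hl.2⟩

theorem post_samples (ok : Fin 2 → Fin N → Prop) (o : Fin 2) (n : ℕ) :
    (samples o n : PCondAlg N _).Post ok fun l => l.length = n ∧ ∀ a ∈ l, ok o a :=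
  Post.replicate (fun _ hx => hx) n

section expect

variable {D : Fin 2 → PMF (Fin N)} {v w : ℝ} {f g : α → ℝ}

theorem expect_pure (a : α) : expect D v f (pure a : PCondAlg N α) = f a := rfl

theorem expect_bind (A : PCondAlg N α) (F : α → PCondAlg N β) (g : β → ℝ) :
    expect D v g (A >>= F) = expect D v (fun a => expect D v g (F a)) A := by
  induction A with
  | halt a => rfl
  | query o q next ih => rw [bind_query]; simp only [expect, ih]
  | random m next ih => rw [bind_random]; simp only [expect, ih]

theorem condOracle_toReal_sum (E : PMF (Fin N)) (S : Set (Fin N)) :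
    (condOracle E S none).toReal + ∑ x, (condOracle E S (some x)).toReal = 1 := by
  have h := (condOracle E S).tsum_coe
  rw [tsum_fintype, Fintype.sum_option] at h
  have h2 := congrArg ENNReal.toReal h
  rw [ENNReal.toReal_add (PMF.apply_ne_top _ _)
    (ENNReal.sum_ne_top.2 fun x _ => PMF.apply_ne_top _ _),
    ENNReal.toReal_sum fun x _ => PMF.apply_ne_top _ _] at h2
  simpa using h2

theorem condOracle_some_eq_zero {E : PMF (Fin N)} {S : Set (Fin N)} {x : Fin N} (hx : E x = 0) :
    condOracle E S (some x) = 0 := by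
  unfold condOracle
  split_ifs with h
  · rw [PMF.map_apply]
    refine ENNReal.tsum_eq_zero.2 fun y => ?_
    split_ifs with hy
    · cases hy
      rw [PMF.filter_apply]
      simp [Set.indicator, hx]
    · rfl
  · simp

/-- An oracle never answers with a point of weight zero, so only outputs reachable through answers
of positive weight contribute. This is how the positivity of D₁ at the representatives and the
lengths of samples enter probability bounds. -/
theorem expect_mono_of_post {P : α → Prop} {A : PCondAlg N α}
    (hA : A.Post (fun o x => D o x ≠ 0) P) (hv : v ≤ w) (h : ∀ a, P a → f a ≤ g a) :
    expect D v f A ≤ expect D w g A := by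
  induction A with
  | halt a => exact h a hA
  | query o q next ih =>
    refine add_le_add (mul_le_mul_of_nonneg_left hv ENNReal.toReal_nonneg)
      (Finset.sum_le_sum fun x _ => ?_)
    by_cases hx : D o x = 0
    · simp [condOracle_some_eq_zero hx]
    · exact mul_le_mul_of_nonneg_left (ih x (hA x hx)) ENNReal.toReal_nonneg
  | random m next ih =>
    exact div_le_div_of_nonneg_right (Finset.sum_le_sum fun i _ => ih i (hA i)) (by positivity)

theorem post_true (ok : Fin 2 → Fin N → Prop) (A : PCondAlg N α) :
    A.Post ok fun _ => True := by
  induction A with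
  | halt a => trivial
  | query o q next ih => exact fun x _ => ih x
  | random m next ih => exact fun i => ih i

theorem expect_mono (A : PCondAlg N α) (hv : v ≤ w) (h : ∀ a, f a ≤ g a) :
    expect D v f A ≤ expect D w g A :=
  expect_mono_of_post (post_true _ A) hv fun a _ => h a

theorem expect_const (A : PCondAlg N α) : expect D v (fun _ => v) A = v := by
  induction A with
  | halt a => rfl
  | query o q next ih =>
    simp only [expect, ih]
    rw [← Finset.sum_mul, ← add_mul, condOracle_toReal_sum, one_mul]
  | random m next ih =>
    simp only [expect, ih]
    simp
    field_simp

/-- Linearity holds only if the failure value is treated like the payoff: it is added here and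
scaled in `expect_const_mul`. Later proofs split or rescale v for this reason. -/
theorem expect_add (A : PCondAlg N α) :
    expect D (v + w) (fun a => f a + g a) A = expect D v f A + expect D w g A := by
  induction A with
  | halt a => rfl
  | query o q next ih =>
    simp only [expect, ih, mul_add, Finset.sum_add_distrib]
    ring
  | random m next ih =>
    simp only [expect, ih, Finset.sum_add_distrib, add_div]

theorem expect_const_mul (c : ℝ) (A : PCondAlg N α) :
    expect D (c * v) (fun a => c * f a) A = c * expect D v f A := by
  induction A with
  | halt a => rfl
  | query o q next ih =>
    simp only [expect, ih, mul_add, Finset.mul_sum]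
    congr 1
    · ring
    · exact Finset.sum_congr rfl fun x _ => by ring
  | random m next ih =>
    simp only [expect, ih, ← Finset.mul_sum, mul_div_assoc]

end expect

/-- The probability that the output violates `P`, where a failed execution is counted with
weight `v`. -/
noncomputable def err (D : Fin 2 → PMF (Fin N)) (v : ℝ) (P : α → Prop) (A : PCondAlg N α) : ℝ :=
  open Classical in expect D v (fun a => if P a then 0 else 1) A

section err

variable {D : Fin 2 → PMF (Fin N)} {v : ℝ} {P Q : α → Prop}

theorem err_pure_of {a : α} (h : P a) : err D v P (pure a : PCondAlg N α) = 0 := by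
  simp [err, expect_pure, h]

theorem err_le_one (hv : v ≤ 1) (A : PCondAlg N α) : err D v P A ≤ 1 := by
  rw [← expect_const (D := D) (v := 1) A]
  exact expect_mono A hv fun a => by split_ifs <;> norm_num

theorem err_mono_of_post {R : α → Prop} {A : PCondAlg N α}
    (hA : A.Post (fun o x => D o x ≠ 0) R) (h : ∀ a, R a → P a → Q a) :
    err D v Q A ≤ err D v P A := by
  refine expect_mono_of_post hA le_rfl fun a ha => ?_
  by_cases hP : P a
  · simp [hP, h a ha hP]
  · rw [if_neg hP]
    split_ifs <;> norm_num

theorem err_mono {A : PCondAlg N α} (h : ∀ a, P a → Q a) :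
    err D v Q A ≤ err D v P A :=
  err_mono_of_post (post_true _ A) fun a _ => h a

theorem err_and_le (hv : 0 ≤ v) (A : PCondAlg N α) :
    err D v (fun a => P a ∧ Q a) A ≤ err D v P A + err D v Q A := by
  unfold err
  rw [← expect_add]
  refine expect_mono A (by linarith) fun a => ?_
  by_cases hP : P a <;> by_cases hQ : Q a <;> simp [hP, hQ]

/-- The union bound for two stages: either the first stage misses P, or the second errs although P
holds. R collects what is certain about the first output. -/
theorem err_bind_le {R : α → Prop} {T : β → Prop} {A : PCondAlg N α}
    {F : α → PCondAlg N β} {e₁ e₂ : ℝ} (hv1 : v ≤ 1)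
    (hA : A.Post (fun o x => D o x ≠ 0) R) (h₁ : err D v P A ≤ e₁) (he : 0 ≤ e₂)
    (h₂ : ∀ a, R a → P a → err D v T (F a) ≤ e₂) :
    err D v T (A >>= F) ≤ e₁ + e₂ := by
  unfold err at *
  rw [expect_bind]
  refine le_trans ?_ (add_le_add h₁ (expect_const (D := D) (v := e₂) A).le)
  rw [← expect_add]
  refine expect_mono_of_post hA (by linarith) fun a ha => ?_
  by_cases hP : P a
  · simpa [hP] using h₂ a ha hP
  · have := err_le_one (D := D) (P := T) hv1 (F a)
    unfold err at this
    simp only [hP, if_false]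
    linarith

theorem expect_indicator_not (A : PCondAlg N α) :
    open Classical in expect D (1 - v) (fun a => if P a then 1 else 0) A = 1 - err D v P A := by
  classical
  have h := expect_add (D := D) (v := 1 - v) (w := v) (f := fun a => if P a then (1 : ℝ) else 0)
    (g := fun a => if P a then (0 : ℝ) else 1) A
  have h1 : (fun a => (if P a then (1 : ℝ) else 0) + if P a then (0 : ℝ) else 1) = fun _ => 1 := by
    funext a; split_ifs <;> norm_num
  rw [h1, sub_add_cancel, expect_const] at h
  unfold err
  linarith

end err

/-- The continuation g is arbitrary so that the induction passes through the nested `bind`s of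
`run`; only the value of g at `none` survives as the failure value. -/
theorem run_bind_apply (D : Fin 2 → PMF (Fin N)) (A : PCondAlg N α) {γ : Type}
    (g : Option α → PMF γ) (y : γ) :
    ((A.run D).bind g y).toReal =
      expect D (g none y).toReal (fun a => (g (some a) y).toReal) A := by
  induction A with
  | halt a => simp [run, expect]
  | query o q next ih =>
    simp only [run, expect, PMF.bind_bind]
    rw [PMF.bind_apply, tsum_fintype, Fintype.sum_option, ENNReal.toReal_add,
      ENNReal.toReal_sum, ENNReal.toReal_mul]
    · simp only [PMF.pure_bind, ENNReal.toReal_mul, ih]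
    · exact fun x _ => ENNReal.mul_ne_top (PMF.apply_ne_top _ _) (PMF.apply_ne_top _ _)
    · exact ENNReal.mul_ne_top (PMF.apply_ne_top _ _) (PMF.apply_ne_top _ _)
    · exact ENNReal.sum_ne_top.2 fun x _ =>
        ENNReal.mul_ne_top (PMF.apply_ne_top _ _) (PMF.apply_ne_top _ _)
  | random m next ih =>
    simp only [run, expect, PMF.bind_bind]
    rw [PMF.bind_apply, tsum_fintype, ENNReal.toReal_sum]
    · simp only [ENNReal.toReal_mul, ih, ← Finset.mul_sum, PMF.uniformOfFintype_apply]
      simp only [Fintype.card_fin, ENNReal.toReal_inv]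
      rw [div_eq_inv_mul]
      norm_cast
    · exact fun x _ => ENNReal.mul_ne_top (PMF.apply_ne_top _ _) (PMF.apply_ne_top _ _)

theorem verdict_apply (D₁ D₂ : PMF (Fin N)) (A : PCondAlg N Verdict) (y : Verdict) :
    (A.verdict D₁ D₂ y).toReal =
      1 - err ![D₁, D₂] (if y = Verdict.reject then 0 else 1) (fun a => a = y) A := by
  classical
  rw [← expect_indicator_not]
  unfold verdict
  rw [← PMF.bind_pure_comp, run_bind_apply]
  congr 1
  · by_cases h : y = Verdict.reject <;> simp [PMF.pure_apply, h]
  · funext a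
    by_cases h : y = a <;> simp [PMF.pure_apply, h, eq_comm]

theorem le_verdict_apply {D₁ D₂ : PMF (Fin N)} {A : PCondAlg N Verdict} {y : Verdict}
    (h : err ![D₁, D₂] (if y = Verdict.reject then 0 else 1) (fun a => a = y) A ≤ 1 / 3) :
    2 / 3 ≤ A.verdict D₁ D₂ y := by
  have h1 := verdict_apply D₁ D₂ A y
  have h2 : ENNReal.ofReal (2 / 3) ≤ A.verdict D₁ D₂ y := by
    refine ENNReal.ofReal_le_of_le_toReal ?_
    linarith
  refine le_trans (le_of_eq ?_) h2
  rw [ENNReal.ofReal_div_of_pos (by norm_num)]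
  norm_num

end PCondAlg

/-! ### Masses of sets and explicit oracle answers -/

/-- The mass of the points that satisfy `P`. -/
noncomputable def pmfMass {N : ℕ} (D : PMF (Fin N)) (P : Fin N → Prop) : ℝ :=
  open Classical in ∑ i, if P i then (D i).toReal else 0

section mass

variable {N : ℕ} {D : PMF (Fin N)} {P Q R : Fin N → Prop}

theorem pmf_sum_toReal (D : PMF (Fin N)) : ∑ i, (D i).toReal = 1 := by
  have h := D.tsum_coe
  rw [tsum_fintype] at h
  rw [← ENNReal.toReal_sum fun x _ => PMF.apply_ne_top _ _, h, ENNReal.toReal_one]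

theorem pmfMass_nonneg : 0 ≤ pmfMass D P :=
  Finset.sum_nonneg fun i _ => by split_ifs <;> simp

theorem pmfMass_mono (h : ∀ i, P i → Q i) : pmfMass D P ≤ pmfMass D Q := by
  refine Finset.sum_le_sum fun i _ => ?_
  by_cases hP : P i
  · simp [hP, h i hP]
  · simp only [hP, if_false]
    split_ifs <;> simp

theorem pmfMass_le_one : pmfMass D P ≤ 1 := by
  rw [← pmf_sum_toReal D]
  refine Finset.sum_le_sum fun i _ => ?_
  split_ifs <;> simp

theorem pmfMass_le_add (h : ∀ i, P i → Q i ∨ R i) : pmfMass D P ≤ pmfMass D Q + pmfMass D R := by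
  unfold pmfMass
  rw [← Finset.sum_add_distrib]
  refine Finset.sum_le_sum fun i _ => ?_
  have hD : 0 ≤ (D i).toReal := ENNReal.toReal_nonneg
  by_cases hP : P i
  · rcases h i hP with hQ | hR
    · by_cases hR : R i <;> simp [hP, hQ, hR]
    · by_cases hQ : Q i <;> simp [hP, hQ, hR]
  · by_cases hQ : Q i <;> by_cases hR : R i <;> simp [hP, hQ, hR]

end mass

section condOracle

variable {N : ℕ} (D : PMF (Fin N))

theorem condOracle_univ : condOracle D Set.univ = D.map some := by
  have h : ∃ i ∈ (Set.univ : Set (Fin N)), i ∈ D.support :=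
    D.support_nonempty.imp fun i hi => ⟨trivial, hi⟩
  unfold condOracle
  rw [dif_pos h]
  congr 1
  ext x
  rw [PMF.filter_apply, Set.indicator_univ, D.tsum_coe, inv_one, mul_one]

theorem pmf_map_some_apply {α : Type} (p : PMF α) (x : α) : p.map some (some x) = p x := by
  classical
  rw [PMF.map_apply, tsum_eq_single x]
  · simp
  · intro y hy
    rw [if_neg]
    simpa using hy.symm

theorem pmf_map_some_none {α : Type} (p : PMF α) : p.map some none = 0 := by
  rw [PMF.map_apply]
  simp

theorem condOracle_pair_of_pos {x y : Fin N} (hxy : x ≠ y)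
    (h : 0 < (D x).toReal + (D y).toReal) :
    condOracle D {x, y} none = 0 ∧ ∀ i, (condOracle D {x, y} (some i)).toReal =
      if i = x then (D x).toReal / ((D x).toReal + (D y).toReal)
      else if i = y then (D y).toReal / ((D x).toReal + (D y).toReal) else 0 := by
  have h1 : ∃ i ∈ ({x, y} : Set (Fin N)), i ∈ D.support := by
    by_contra! h1
    have hx := h1 x (by simp)
    have hy := h1 y (by simp)
    rw [PMF.mem_support_iff, not_not] at hx hy
    simp [hx, hy] at h
  unfold condOracle
  rw [dif_pos h1]
  refine ⟨pmf_map_some_none _, fun i => ?_⟩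
  have hs : ∑' z, ({x, y} : Set (Fin N)).indicator D z = D x + D y := by
    classical
    rw [tsum_fintype]
    simp only [Set.indicator_apply, Set.mem_insert_iff, Set.mem_singleton_iff]
    rw [← Finset.sum_filter]
    have : Finset.univ.filter (fun z => z = x ∨ z = y) = {x, y} := by ext z; simp
    rw [this, Finset.sum_pair hxy]
  rw [pmf_map_some_apply, PMF.filter_apply, hs, ENNReal.toReal_mul, ENNReal.toReal_inv,
    ENNReal.toReal_add (PMF.apply_ne_top _ _) (PMF.apply_ne_top _ _)]
  by_cases hix : i = x
  · simp [hix, div_eq_mul_inv]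
  · by_cases hiy : i = y
    · simp [hiy, hxy.symm, div_eq_mul_inv]
    · simp [hix, hiy]

theorem condOracle_pair_of_zero {x y : Fin N}
    (h : (D x).toReal + (D y).toReal = 0) :
    condOracle D {x, y} = PMF.pure none := by
  have h1 : ¬ ∃ i ∈ ({x, y} : Set (Fin N)), i ∈ D.support := by
    have hx : 0 ≤ (D x).toReal := ENNReal.toReal_nonneg
    have hy : 0 ≤ (D y).toReal := ENNReal.toReal_nonneg
    have hx0 : D x = 0 := by
      have : (D x).toReal = 0 := by linarith
      simpa [ENNReal.toReal_eq_zero_iff, PMF.apply_ne_top] using this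
    have hy0 : D y = 0 := by
      have : (D y).toReal = 0 := by linarith
      simpa [ENNReal.toReal_eq_zero_iff, PMF.apply_ne_top] using this
    simp [hx0, hy0]
  unfold condOracle
  rw [dif_neg h1]

end condOracle

/-! ### Chernoff bounds for repeated queries -/

namespace PCondAlg

variable {N : ℕ} {α : Type} {D : Fin 2 → PMF (Fin N)} {v : ℝ}

theorem expect_ask_whole (o : Fin 2) (f : Fin N → ℝ) :
    expect D v f (ask o .whole) = ∑ i, (D o i).toReal * f i := by
  simp only [ask, expect, PCondQuery.toSet, condOracle_univ, pmf_map_some_apply,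
    pmf_map_some_none, expect_pure]
  simp

theorem expect_ask_pair_of_pos (o : Fin 2) {x y : Fin N} (hxy : x ≠ y)
    (h : 0 < (D o x).toReal + (D o y).toReal) (f : Fin N → ℝ) :
    expect D v f (ask o (.pair x y hxy)) = ∑ i,
      (if i = x then (D o x).toReal / ((D o x).toReal + (D o y).toReal)
      else if i = y then (D o y).toReal / ((D o x).toReal + (D o y).toReal) else 0) * f i := by
  obtain ⟨h0, h1⟩ := condOracle_pair_of_pos (D o) hxy h
  simp only [ask, expect, PCondQuery.toSet, h0, h1, expect_pure]
  simp

theorem expect_ask_pair_of_zero (o : Fin 2) {x y : Fin N} (hxy : x ≠ y)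
    (h : (D o x).toReal + (D o y).toReal = 0) (f : Fin N → ℝ) :
    expect D v f (ask o (.pair x y hxy)) = v := by
  simp only [ask, expect, PCondQuery.toSet, condOracle_pair_of_zero (D o) h]
  simp

/-- `A` outputs `i` with probability `q i`, and it never fails. -/
def HasLaw (D : Fin 2 → PMF (Fin N)) (A : PCondAlg N (Fin N)) (q : Fin N → ℝ) : Prop :=
  (∀ i, 0 ≤ q i) ∧ ∑ i, q i = 1 ∧ ∀ v f, expect D v f A = ∑ i, q i * f i

theorem hasLaw_ask_whole (o : Fin 2) : HasLaw D (ask o .whole) fun i => (D o i).toReal :=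
  ⟨fun _ => ENNReal.toReal_nonneg, pmf_sum_toReal _, fun _ f => expect_ask_whole o f⟩

/-- The moment generating function of a count of independent trials factors. Pulling one factor c
out of the expectation turns v into v / c, so the induction must generalize over v; the result is
independent of v because `A` never fails. -/
theorem expect_replicate_exp {A : PCondAlg N (Fin N)} {q : Fin N → ℝ} (hA : HasLaw D A q)
    (P : Fin N → Prop) (l : ℝ) (n : ℕ) (v : ℝ) :
    open Classical in expect D v (fun L => Real.exp (l * (L.countP fun i => decide (P i) : ℕ)))
      (replicate n A) = (∑ i, q i * Real.exp (l * if P i then 1 else 0)) ^ n := by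
  classical
  induction n generalizing v with
  | zero => simp [replicate, expect_pure]
  | succ n ih =>
    rw [replicate, expect_bind, hA.2.2, pow_succ', Finset.sum_mul]
    refine Finset.sum_congr rfl fun i _ => ?_
    rw [mul_assoc]
    congr 1
    rw [expect_bind]
    simp only [expect_pure]
    set c := Real.exp (l * if P i then 1 else 0) with hc
    have hc0 : c ≠ 0 := Real.exp_ne_zero _
    rw [← ih (v / c), ← expect_const_mul, mul_div_cancel₀ _ hc0]
    congr 1
    funext L
    rw [hc, ← Real.exp_add, List.countP_cons]
    congr 1
    by_cases hP : P i <;> simp [hP]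
    ring

theorem sum_mul_exp_le {q : Fin N → ℝ} (h0 : ∀ i, 0 ≤ q i) (h1 : ∑ i, q i = 1)
    (P : Fin N → Prop) {l : ℝ} (hl : |l| ≤ 1) :
    open Classical in ∑ i, q i * Real.exp (l * if P i then 1 else 0) ≤
      Real.exp ((∑ i, if P i then q i else 0) * (l + l ^ 2)) := by
  classical
  have h : Real.exp l ≤ 1 + (l + l ^ 2) := by
    have := Real.abs_exp_sub_one_sub_id_le hl
    linarith [(abs_le.1 this).2]
  have h2 : ∑ i, q i * Real.exp (l * if P i then 1 else 0) ≤
      ∑ i, (q i + (if P i then q i else 0) * (l + l ^ 2)) := by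
    refine Finset.sum_le_sum fun i _ => ?_
    by_cases hP : P i
    · simp only [hP, if_true, mul_one]
      nlinarith [h0 i]
    · simp [hP]
  rw [Finset.sum_add_distrib, h1, ← Finset.sum_mul] at h2
  refine h2.trans ?_
  rw [add_comm]
  exact Real.add_one_le_exp _

/-- A multiplicative Chernoff bound. -/
theorem err_sampleFraction_le {A : PCondAlg N (Fin N)} {q : Fin N → ℝ} (hA : HasLaw D A q)
    (P : Fin N → Prop) {p β η : ℝ} (hp : p = open Classical in ∑ i, if P i then q i else 0)
    (hη : 0 ≤ η) (hη1 : η ≤ 2) (n : ℕ) :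
    err D v (fun L => |sampleFraction L P - p| ≤ η * (p + β)) (replicate n A) ≤
      2 * Real.exp (-(n * η ^ 2 * β / 2)) := by
  classical
  have hp0 : 0 ≤ p := by
    rw [hp]
    exact Finset.sum_nonneg fun i _ => by split_ifs <;> simp [hA.1 i]
  -- Both tails at once, with l = η/2 and l = -η/2. The failure value is v/2 so that the two
  -- expectations add up to failure value v. The term p l² = p η²/4 is absorbed by half of the
  -- deviation term p η²/2, and what remains is η²β/2.
  have key : ∀ l : ℝ, |l| = η / 2 →
      expect D (v / 2) (fun L => Real.exp (-(l * (n * p)) - η / 2 * (n * (η * (p + β)))) *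
        Real.exp (l * (L.countP fun i => decide (P i) : ℕ))) (replicate n A) ≤
        Real.exp (-(n * η ^ 2 * β / 2)) := by
    intro l hl
    set c := Real.exp (-(l * (n * p)) - η / 2 * (n * (η * (p + β)))) with hc
    have hc0 : c ≠ 0 := Real.exp_ne_zero _
    have h1 := expect_const_mul (D := D) (v := v / 2 / c) (f := fun L =>
      Real.exp (l * (L.countP fun i => decide (P i) : ℕ))) c (replicate n A)
    rw [mul_div_cancel₀ _ hc0] at h1
    rw [h1, expect_replicate_exp hA]
    have h2 := sum_mul_exp_le hA.1 hA.2.1 P (l := l) (by rw [hl]; linarith)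
    rw [← hp] at h2
    have h3 : (∑ i, q i * Real.exp (l * if P i then 1 else 0)) ^ n ≤
        Real.exp (n * (p * (l + l ^ 2))) := by
      rw [Real.exp_nat_mul]
      refine pow_le_pow_left₀ (Finset.sum_nonneg fun i _ =>
        mul_nonneg (hA.1 i) (Real.exp_pos _).le) h2 n
    refine (mul_le_mul_of_nonneg_left h3 (Real.exp_pos _).le).trans ?_
    rw [← Real.exp_add, Real.exp_le_exp]
    have hl2 : l ^ 2 = (η / 2) ^ 2 := by rw [← sq_abs, hl]
    rw [hl2]
    have : 0 ≤ (n : ℝ) * p * η ^ 2 := by positivity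
    nlinarith
  have hmain := add_le_add (key (η / 2) (abs_of_nonneg (by positivity)))
    (key (-(η / 2)) (by rw [abs_neg]; exact abs_of_nonneg (by positivity)))
  rw [← expect_add, ← two_mul (Real.exp _)] at hmain
  refine le_trans ?_ hmain
  refine expect_mono_of_post (Post.replicate (post_true _ A) n) (by linarith) fun L hL => ?_
  have hlen := hL.1
  split_ifs with h
  · positivity
  · rw [← Real.exp_add, ← Real.exp_add]
    have hcnt : (n : ℝ) * sampleFraction L P = (L.countP fun i => decide (P i) : ℕ) := by
      unfold sampleFraction
      rw [hlen]
      rcases Nat.eq_zero_or_pos n with h0 | h0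
      · subst h0
        rw [List.length_eq_zero_iff] at hlen
        simp [hlen]
      · field_simp
    rw [← hcnt]
    push Not at h
    have hn : (0 : ℝ) ≤ η / 2 * n := by positivity
    rcases le_abs.1 h.le with h1 | h1
    · have h2 : 1 ≤ Real.exp (-(η / 2 * (n * p)) - η / 2 * (n * (η * (p + β))) +
        η / 2 * (n * sampleFraction L P)) := by
        rw [Real.one_le_exp_iff]
        nlinarith [mul_le_mul_of_nonneg_left h1 hn]
      linarith [Real.exp_pos (-(-(η / 2) * (n * p)) - η / 2 * (n * (η * (p + β))) +
        -(η / 2) * (n * sampleFraction L P))]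
    · have h2 : 1 ≤ Real.exp (-(-(η / 2) * (n * p)) - η / 2 * (n * (η * (p + β))) +
        -(η / 2) * (n * sampleFraction L P)) := by
        rw [Real.one_le_exp_iff]
        nlinarith [mul_le_mul_of_nonneg_left h1 hn]
      linarith [Real.exp_pos (-(η / 2 * (n * p)) - η / 2 * (n * (η * (p + β))) +
        η / 2 * (n * sampleFraction L P))]

theorem err_samples_le (o : Fin 2) (P : Fin N → Prop) {β η : ℝ}
    (hη : 0 ≤ η) (hη1 : η ≤ 2) (n : ℕ) :
    err D v (fun L => |sampleFraction L P - pmfMass (D o) P| ≤ η * (pmfMass (D o) P + β))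
      (samples o n) ≤ 2 * Real.exp (-(n * η ^ 2 * β / 2)) :=
  err_sampleFraction_le (hasLaw_ask_whole o) P rfl hη hη1 n

/-- A sample that misses the set has fraction 0, which the Chernoff bound with η = 1/4 and β = τ
excludes when the mass exceeds τ. -/
theorem err_hit_le (o : Fin 2) (P : Fin N → Prop) {τ : ℝ}
    (n : ℕ) :
    err D v (fun L => pmfMass (D o) P ≤ τ ∨ ∃ i ∈ L, P i)
      (samples o n) ≤ 2 * Real.exp (-(n * τ / 32)) := by
  have h := err_samples_le (D := D) (v := v) (β := τ) (η := 1 / 4) o P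
    (by norm_num) (by norm_num) n
  refine le_trans (err_mono fun L hL => ?_) (h.trans (le_of_eq ?_))
  · by_contra! hno
    have : sampleFraction L P = 0 := by
      unfold sampleFraction
      rw [List.countP_eq_zero.2 (by simpa using hno.2)]
      simp
    rw [this, abs_le] at hL
    linarith [hno.1]
  · congr 3
    ring

end PCondAlg

/-! ### Reliability of comparisons -/

/-- The weights of `x` and `y` differ by a factor of at most `1 + γ`. -/
def NearWeight {N : ℕ} (γ : ℝ) (D : PMF (Fin N)) (x y : Fin N) : Prop :=
  (D y).toReal ≤ (1 + γ) * (D x).toReal ∧ (D x).toReal ≤ (1 + γ) * (D y).toReal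

theorem NearWeight.mono {N : ℕ} {γ γ' : ℝ} {D : PMF (Fin N)} {x y : Fin N}
    (h : NearWeight γ D x y) (hγ : γ ≤ γ') : NearWeight γ' D x y :=
  ⟨h.1.trans (mul_le_mul_of_nonneg_right (by linarith) ENNReal.toReal_nonneg),
    h.2.trans (mul_le_mul_of_nonneg_right (by linarith) ENNReal.toReal_nonneg)⟩

theorem nearWeight_self {N : ℕ} {γ : ℝ} (hγ : 0 ≤ γ) (D : PMF (Fin N)) (x : Fin N) :
    NearWeight γ D x x := by
  have : 0 ≤ (D x).toReal := ENNReal.toReal_nonneg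
  constructor <;> nlinarith

theorem CompareResult.Close.mono {γ γ' : ℝ} {r : CompareResult} (h : r.Close γ) (h0 : 0 ≤ γ)
    (hγ : γ ≤ γ') : r.Close γ' := by
  cases r with
  | low => exact h
  | high => exact h
  | ratio ρ =>
    exact ⟨(one_div_le_one_div_of_le (by linarith) (by linarith)).trans h.1, by linarith [h.2]⟩

/-- Up to a precision of `θ`, the result tells how the weights of `x` and `y` compare. -/
def CompareResult.Reliable {N : ℕ} (D : PMF (Fin N)) (x y : Fin N) (θ : ℝ)
    (r : CompareResult) : Prop :=
  ∀ γ, 0 ≤ γ → γ ≤ 1 / 2 → (r.Close γ → NearWeight (γ + θ / 2) D x y) ∧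
    (D x ≠ 0 → NearWeight γ D x y → r.Close (γ + θ / 2))

/-- The hypothesis gives exp(-z) ≤ δ², and 2δ² ≤ δ because δ ≤ 1/2. -/
theorem two_mul_exp_neg_le {δ z : ℝ} (hδ : 0 < δ) (hδ1 : δ ≤ 1 / 2)
    (hz : 2 * Real.log (1 / δ) ≤ z) : 2 * Real.exp (-z) ≤ δ := by
  have h1 : Real.exp (-z) ≤ Real.exp (Real.log δ + Real.log δ) := by
    rw [Real.exp_le_exp]
    rw [one_div, Real.log_inv] at hz
    linarith
  rw [Real.exp_add, Real.exp_log hδ] at h1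
  nlinarith

/-- The map μ ↦ μ/(1-μ) sends the conditional probability of y to the ratio of weights. If the ratio
is within 1 + γ ≤ 3/2, then μ and 1 - μ are at least 2/5, well above the cutoff 2/15 for `low` and
`high`; conversely a numerical result keeps m and 1 - m at least 2/15. In both regimes an error
θ/400 in μ moves the ratio bound by at most θ/2. -/
theorem reliable_of_abs_sub_le {N : ℕ} {D : PMF (Fin N)} {x y : Fin N} {θ m : ℝ} (hθ : 0 < θ)
    (hθ1 : θ ≤ 1) (hpos : 0 < (D x).toReal + (D y).toReal)
    (hm : |m - (D y).toReal / ((D x).toReal + (D y).toReal)| ≤ θ / 400) :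
    CompareResult.Reliable D x y θ (if m < 2 / 3 * (1 / (4 + 1)) then .low
      else if 1 - m < 2 / 3 * (1 / (4 + 1)) then .high else .ratio (m / (1 - m))) := by
  intro γ hγ hγ1
  have ha : 0 ≤ (D x).toReal := ENNReal.toReal_nonneg
  have hb : 0 ≤ (D y).toReal := ENNReal.toReal_nonneg
  unfold NearWeight
  set a := (D x).toReal with ha'
  set b := (D y).toReal
  obtain ⟨μ, hμ⟩ : ∃ μ, μ = b / (a + b) := ⟨_, rfl⟩
  rw [← hμ] at hm
  have hbμ : b = μ * (a + b) := by rw [hμ]; field_simp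
  have haμ : a = (1 - μ) * (a + b) := by linarith
  obtain ⟨h1, h2⟩ := abs_le.1 hm
  constructor
  · intro h
    split_ifs at h with hl hh
    · exact h.elim
    · exact h.elim
    · obtain ⟨h3, h4⟩ := h
      have hm1 : 0 < 1 - m := by linarith
      have hm0 : 2 / 15 ≤ m := by linarith
      have hm2 : 2 / 15 ≤ 1 - m := by linarith
      rw [div_le_div_iff₀ (by linarith) hm1] at h3
      rw [div_le_iff₀ hm1] at h4
      constructor
      · have : μ ≤ (1 + (γ + θ / 2)) * (1 - μ) := by nlinarith
        nlinarith
      · have : 1 - μ ≤ (1 + (γ + θ / 2)) * μ := by nlinarith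
        nlinarith
  · rintro hx ⟨h3, h4⟩
    have h5 : μ ≤ (1 + γ) * (1 - μ) := by
      rw [hbμ, haμ] at h3
      refine le_of_mul_le_mul_right ?_ hpos
      nlinarith
    have h6 : 1 - μ ≤ (1 + γ) * μ := by
      rw [hbμ, haμ] at h4
      refine le_of_mul_le_mul_right ?_ hpos
      nlinarith
    have h7 : 2 / 5 ≤ μ := by nlinarith
    have h8 : 2 / 5 ≤ 1 - μ := by nlinarith
    rw [if_neg (by linarith), if_neg (by linarith)]
    have hm1 : 0 < 1 - m := by linarith
    constructor
    · rw [div_le_div_iff₀ (by linarith) hm1]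
      nlinarith
    · rw [div_le_iff₀ hm1]
      nlinarith

namespace PCondAlg

variable {N : ℕ} {D : Fin 2 → PMF (Fin N)} {v : ℝ}

theorem err_bind_pure_le {α β : Type} {P : α → Prop} {T : β → Prop} {A : PCondAlg N α}
    {g : α → β} {e : ℝ} (hv1 : v ≤ 1) (h₁ : err D v P A ≤ e) (h : ∀ a, P a → T (g a)) :
    err D v T (A >>= fun a => pure (g a)) ≤ e := by
  rw [← add_zero e]
  exact err_bind_le hv1 (post_true _ A) h₁ le_rfl fun a _ ha => (err_pure_of (h a ha)).le

theorem hasLaw_ask_pair {o : Fin 2} {x y : Fin N} (hxy : x ≠ y)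
    (h : 0 < (D o x).toReal + (D o y).toReal) : HasLaw D (ask o (.pair x y hxy)) fun i =>
      if i = x then (D o x).toReal / ((D o x).toReal + (D o y).toReal)
      else if i = y then (D o y).toReal / ((D o x).toReal + (D o y).toReal) else 0 := by
  refine ⟨fun i => by dsimp only; split_ifs <;> positivity, ?_, fun v f => expect_ask_pair_of_pos o hxy h f⟩
  have h1 := expect_ask_pair_of_pos (D := D) (v := 1) o hxy h fun _ => 1
  rw [expect_const] at h1
  simpa using h1.symm

theorem err_pcondCompare_le {c : SampleConstants} (hc : c.cmp = 10 ^ 6) {o : Fin 2}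
    (x y : Fin N) {θ δ : ℝ} (hθ : 0 < θ) (hθ1 : θ ≤ 1) (hδ : 0 < δ) (hδ1 : δ ≤ 1 / 2)
    (hv1 : v ≤ 1) (hv : v = 0 ∨ D o x ≠ 0) :
    err D v (CompareResult.Reliable (D o) x y θ) (pcondCompare c o x y (θ / 4) 4 δ) ≤ δ := by
  classical
  unfold pcondCompare
  split_ifs with hxy
  · subst hxy
    rw [err_pure_of]
    · exact hδ.le
    · refine fun γ hγ _ => ⟨fun _ => nearWeight_self (by positivity) _ _, fun _ _ => ⟨?_, ?_⟩⟩
      · rw [div_le_one (by positivity)]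
        linarith
      · linarith
  · have hlog : 0 < Real.log (1 / δ) := by
      refine Real.log_pos ?_
      rw [lt_div_iff₀ hδ]
      linarith
    set n := ⌈c.cmp * (4 * Real.log (1 / δ) / (θ / 4) ^ 2)⌉₊ with hn
    have hn1 : c.cmp * (4 * Real.log (1 / δ) / (θ / 4) ^ 2) ≤ n := Nat.le_ceil _
    have hx : 0 ≤ (D o x).toReal := ENNReal.toReal_nonneg
    have hy : 0 ≤ (D o y).toReal := ENNReal.toReal_nonneg
    rcases (add_nonneg hx hy).eq_or_lt with h0 | hpos
    · have hv0 : v = 0 := by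
        refine hv.resolve_right fun hne => hne ?_
        have : (D o x).toReal = 0 := by linarith
        simpa [ENNReal.toReal_eq_zero_iff, PMF.apply_ne_top] using this
      obtain ⟨k, hk⟩ : ∃ k, n = k + 1 := by
        refine Nat.exists_eq_succ_of_ne_zero (Nat.ceil_pos.2 ?_).ne'
        rw [hc]
        positivity
      rw [hk, replicate, err, expect_bind, expect_bind, expect_ask_pair_of_zero o hxy h0.symm, hv0]
      exact hδ.le
    · have hlaw := hasLaw_ask_pair (D := D) hxy hpos
      have hp : (D o y).toReal / ((D o x).toReal + (D o y).toReal) = ∑ i, if i = y then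
          (if i = x then (D o x).toReal / ((D o x).toReal + (D o y).toReal)
          else if i = y then (D o y).toReal / ((D o x).toReal + (D o y).toReal) else 0) else 0 := by
        simp [Ne.symm hxy]
      -- With β = 1 and p ≤ 1 the error θ/800 · (p + β) is at most the θ/400 that
      -- `reliable_of_abs_sub_le` asks for.
      have h1 := err_sampleFraction_le (v := v) (β := 1) (η := θ / 800) hlaw (fun a => a = y)
        (hp.trans (Finset.sum_congr rfl fun i _ => by congr))  (by positivity) (by linarith) n
      refine err_bind_pure_le hv1 (h1.trans (two_mul_exp_neg_le hδ hδ1 ?_)) fun L hL => ?_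
      · rw [hc] at hn1
        have : 10 ^ 6 * (4 * Real.log (1 / δ) / (θ / 4) ^ 2) * (θ / 800) ^ 2 * 1 / 2 =
          50 * Real.log (1 / δ) := by
          field_simp
          norm_num
        calc 2 * Real.log (1 / δ) ≤ 50 * Real.log (1 / δ) := by linarith
          _ = _ := this.symm
          _ ≤ _ := by gcongr
      · refine reliable_of_abs_sub_le hθ hθ1 hpos (hL.trans ?_)
        have : (D o y).toReal / ((D o x).toReal + (D o y).toReal) ≤ 1 := by
          rw [div_le_one hpos]
          linarith
        nlinarith

theorem err_tabulate_le {α : Type} {d : α} {f : Fin N → PCondAlg N α} {P : Fin N → α → Prop}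
    {e : ℝ} (hv1 : v ≤ 1) (he : 0 ≤ e) (l : List (Fin N))
    (h : ∀ y ∈ l, err D v (P y) (f y) ≤ e) :
    err D v (fun g => ∀ y ∈ l, P y (g y)) (tabulate d f l) ≤ l.length * e := by
  induction l with
  | nil =>
    rw [tabulate, err_pure_of (by simp)]
    simp
  | cons y l ih =>
    simp only [List.mem_cons, forall_eq_or_imp] at h
    rw [tabulate, List.length_cons, Nat.cast_succ, add_one_mul, add_comm]
    refine err_bind_le hv1 (post_true _ _) h.1 (by positivity) fun a _ ha => ?_
    refine err_bind_pure_le hv1 (ih h.2) fun g hg z hz => ?_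
    by_cases hzy : z = y
    · subst hzy
      simpa using ha
    · rw [Function.update_of_ne hzy]
      exact hg z ((List.mem_cons.1 hz).resolve_left hzy)

end PCondAlg

/-! ### Random radius and neighborhood estimation -/

theorem sampleFraction_mono {N : ℕ} {S : List (Fin N)} {P Q : Fin N → Prop}
    (h : ∀ y ∈ S, P y → Q y) : sampleFraction S P ≤ sampleFraction S Q := by
  classical
  unfold sampleFraction
  refine div_le_div_of_nonneg_right ?_ (Nat.cast_nonneg _)
  exact_mod_cast List.countP_mono_left fun y hy hP => by simpa using h y hy (by simpa using hP)

/-- A nondecreasing function with values in `[0, 1]` has few large increments. -/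
theorem card_large_increments_le {g : ℕ → ℝ} (hg : Monotone g) (h0 : ∀ n, 0 ≤ g n)
    (h1 : ∀ n, g n ≤ 1) {τ : ℝ} (hτ : 0 < τ) (n : ℕ) :
    open Classical in ∑ i : Fin n, (if g (i + 1) ≤ g i + τ then (0 : ℝ) else 1) ≤ 1 / τ := by
  classical
  have h2 : ∀ i : Fin n, (if g (i + 1) ≤ g i + τ then (0 : ℝ) else 1) ≤
      (g (i + 1) - g i) / τ := by
    intro i
    split_ifs with h
    · exact div_nonneg (sub_nonneg.2 (hg (Nat.le_succ _))) hτ.le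
    · rw [le_div_iff₀ hτ]
      linarith
  refine (Finset.sum_le_sum fun i _ => h2 i).trans ?_
  rw [← Finset.sum_div, Fin.sum_univ_eq_sum_range (fun i => g (i + 1) - g i), Finset.sum_range_sub]
  exact div_le_div_of_nonneg_right (by linarith [h0 0, h1 n]) hτ.le

/-- Here w is the measured fraction, squeezed between the fractions f and f' of the exact inner and
outer neighborhoods. A light shell makes both of them estimates of p. -/
theorem abs_sub_le_of_shell {w p p' f f' η β : ℝ} (hη : 0 ≤ η) (hη1 : η ≤ 1) (hβ : 0 ≤ β)
    (hp : 0 ≤ p) (hshell : p' ≤ p + η * β / 16) (hf : |f - p| ≤ η / 16 * (p + β))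
    (hf' : |f' - p'| ≤ η / 16 * (p' + β)) (h1 : f ≤ w) (h2 : w ≤ f') :
    |w - p| ≤ η / 4 * (p + β) := by
  have h3 : 0 ≤ η * β := mul_nonneg hη hβ
  have h4 : 0 ≤ η * p := mul_nonneg hη hp
  have h5 : η * (η * β) ≤ 1 * (η * β) := mul_le_mul_of_nonneg_right hη1 h3
  have h6 : η * p' ≤ η * (p + η * β / 16) := mul_le_mul_of_nonneg_left hshell hη
  rw [abs_le] at *
  constructor <;> nlinarith

namespace PCondAlg

variable {N : ℕ} {D : Fin 2 → PMF (Fin N)} {v : ℝ}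

theorem err_random (m : ℕ) (P : Fin (m + 1) → Prop) :
    err D v P (random m pure) = open Classical in (∑ i, if P i then (0 : ℝ) else 1) / (m + 1) :=
  rfl

/-- The shell width equals the grid step, so shells of consecutive radii telescope inside total mass
1: at most 1/τ of the at least κ/θ radii have a shell heavier than τ. -/
theorem err_random_shell_le (E : PMF (Fin N)) (x : Fin N) {κ θ τ : ℝ} (hκ : 0 < κ) (hθ : 0 < θ)
    (hτ : 0 < τ) :
    err D v (fun i : Fin (⌈κ / θ⌉₊ - 1 + 1) =>
      pmfMass E (NearWeight (κ + (i : ℕ) * θ + θ) E x) ≤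
        pmfMass E (NearWeight (κ + (i : ℕ) * θ) E x) + τ)
      (random (⌈κ / θ⌉₊ - 1) pure) ≤ θ / (κ * τ) := by
  rw [err_random]
  have hM : (⌈κ / θ⌉₊ - 1 + 1 : ℕ) = ⌈κ / θ⌉₊ :=
    Nat.sub_add_cancel (Nat.ceil_pos.2 (by positivity))
  have hM' : κ / θ ≤ ((⌈κ / θ⌉₊ - 1 : ℕ) : ℝ) + 1 := by
    rw [← Nat.cast_succ, Nat.succ_eq_add_one, hM]
    exact Nat.le_ceil _
  have h := card_large_increments_le (g := fun n => pmfMass E (NearWeight (κ + n * θ) E x))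
    (fun a b hab => pmfMass_mono fun i hi => hi.mono (by gcongr)) (fun _ => pmfMass_nonneg)
    (fun _ => pmfMass_le_one) hτ (⌈κ / θ⌉₊ - 1 + 1)
  rw [div_le_iff₀ (by positivity)]
  calc _ ≤ 1 / τ := by
        refine le_trans (le_of_eq ?_) h
        refine Finset.sum_congr rfl fun i _ => ?_
        congr 4
        push_cast
        ring
    _ = θ / (κ * τ) * (κ / θ) := by field_simp
    _ ≤ _ := by gcongr

theorem err_estimateNeighborhood_le {c : SampleConstants} (hc : c.cmp = 10 ^ 6)
    (hc' : c.nbh = 10 ^ 4) {o : Fin 2} {x : Fin N} (hx : D o x ≠ 0) {κ β η δ : ℝ}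
    (hκ : 0 < κ) (hκ1 : κ ≤ 1 / 100) (hβ : 0 < β) (hβ1 : β ≤ 1) (hη : 0 < η) (hη1 : η ≤ 1)
    (hδ : 0 < δ) (hδ1 : δ ≤ 1 / 2) (hv0 : 0 ≤ v) (hv1 : v ≤ 1) :
    err D v (fun z : ℝ × ℝ => κ ≤ z.2 ∧ z.2 ≤ 2 * κ ∧
      pmfMass (D o) (NearWeight (z.2 + κ * η * β * δ / 64) (D o) x) ≤
        pmfMass (D o) (NearWeight z.2 (D o) x) + η * β / 16 ∧
      |z.1 - pmfMass (D o) (NearWeight z.2 (D o) x)| ≤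
        η / 4 * (pmfMass (D o) (NearWeight z.2 (D o) x) + β))
      (estimateNeighborhood c o x κ β η δ) ≤ δ := by
  classical
  unfold estimateNeighborhood
  dsimp only
  obtain ⟨θ, hθ⟩ : ∃ θ, θ = κ * η * β * δ / 64 := ⟨_, rfl⟩
  rw [← hθ]
  have hθ0 : 0 < θ := by rw [hθ]; positivity
  have hθκ : θ ≤ κ := by
    have : η * β * δ ≤ 1 := by
      have := mul_le_mul hη1 hβ1 hβ.le zero_le_one
      nlinarith [mul_pos hη hβ]
    rw [hθ]
    nlinarith
  have hlog : 0 < Real.log (1 / δ) := by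
    refine Real.log_pos ?_
    rw [lt_div_iff₀ hδ]
    linarith
  set s := ⌈c.nbh * (Real.log (1 / δ) / (β * η ^ 2))⌉₊ with hs
  have hs0 : 0 < s := Nat.ceil_pos.2 (by rw [hc']; positivity)
  have hs1 : c.nbh * (Real.log (1 / δ) / (β * η ^ 2)) ≤ s := Nat.le_ceil _
  have hs0' : (1 : ℝ) ≤ s := by exact_mod_cast hs0
  -- The error budget: δ/4 for a heavy shell, δ/4 for each of the two Chernoff bounds (inner and
  -- outer neighborhood), δ/4 for all comparisons together.
  have hδ4 : δ = δ / 4 + (δ / 2 + δ / 4) := by ring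
  rw [show err D v _ _ ≤ δ ↔ err D v _ _ ≤ δ / 4 + (δ / 2 + δ / 4) by rw [← hδ4]]
  have hshell := err_random_shell_le (D := D) (v := v) (D o) x hκ hθ0 (τ := η * β / 16)
    (by positivity)
  rw [show θ / (κ * (η * β / 16)) = δ / 4 by rw [hθ]; field_simp; norm_num] at hshell
  refine err_bind_le hv1 (post_true _ _) hshell (by positivity) fun i _ hi => ?_
  set α := κ + (i : ℕ) * θ with hα
  have hακ : κ ≤ α := by
    have : 0 ≤ ((i : ℕ) : ℝ) * θ := by positivity
    linarith
  have hα2 : α ≤ 2 * κ := by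
    have h1 : (i : ℕ) < κ / θ := by
      have h2 : (i : ℕ) < ⌈κ / θ⌉₊ := by
        have h3 := i.2
        have h4 : 0 < ⌈κ / θ⌉₊ := Nat.ceil_pos.2 (by positivity)
        omega
      exact Nat.lt_ceil.1 h2
    rw [lt_div_iff₀ hθ0] at h1
    linarith
  have hchern : ∀ P : Fin N → Prop, err D v (fun S => |sampleFraction S P - pmfMass (D o) P| ≤
      η / 16 * (pmfMass (D o) P + β)) (samples o s) ≤ δ / 4 := by
    intro P
    refine (err_samples_le o P (by positivity) (by linarith) s).trans
      (two_mul_exp_neg_le (by positivity) (by linarith) ?_)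
    have hl4 : Real.log (1 / (δ / 4)) ≤ 3 * Real.log (1 / δ) := by
      rw [show (3 : ℝ) * Real.log (1 / δ) = Real.log ((1 / δ) ^ 3) by
        rw [Real.log_pow]; norm_num]
      refine Real.log_le_log (by positivity) ?_
      have h2 : 2 ≤ 1 / δ := by
        rw [le_div_iff₀ hδ]
        linarith
      calc 1 / (δ / 4) = 2 ^ 2 * (1 / δ) := by field_simp; norm_num
        _ ≤ (1 / δ) ^ 2 * (1 / δ) := by gcongr
        _ = (1 / δ) ^ 3 := by ring
    calc 2 * Real.log (1 / (δ / 4)) ≤ 10 ^ 4 * (Real.log (1 / δ)) / 512 := by linarith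
      _ = c.nbh * (Real.log (1 / δ) / (β * η ^ 2)) * (η / 16) ^ 2 * β / 2 := by
        rw [hc']
        field_simp
        norm_num
      _ ≤ _ := by gcongr
  have hboth := (err_and_le (P := fun S => |sampleFraction S (NearWeight α (D o) x) -
      pmfMass (D o) (NearWeight α (D o) x)| ≤
        η / 16 * (pmfMass (D o) (NearWeight α (D o) x) + β)) hv0 (samples o s)).trans
    (add_le_add (hchern (NearWeight α (D o) x)) (hchern (NearWeight (α + θ) (D o) x)))
  rw [show δ / 4 + δ / 4 = δ / 2 by ring] at hboth
  refine err_bind_le hv1 (post_samples _ o s) hboth (by positivity) fun S hS hSf => ?_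
  have htab := err_tabulate_le (D := D) (d := CompareResult.low)
    (P := fun y r => r.Reliable (D o) x y θ) (e := δ / (4 * s)) hv1 (by positivity) S.dedup
    fun y _ => err_pcondCompare_le hc x y hθ0 (by linarith) (by positivity) (by
      rw [div_le_iff₀ (by positivity)]
      linarith) hv1 (Or.inr hx)
  refine err_bind_pure_le hv1 (htab.trans ?_) fun ρ hρ => ?_
  · have hlen : (S.dedup.length : ℝ) ≤ s := by
      rw [← hS.1]
      exact_mod_cast S.dedup_sublist.length_le
    calc _ ≤ (s : ℝ) * (δ / (4 * s)) := by gcongr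
      _ = δ / 4 := by field_simp
  · refine ⟨hακ, hα2, hi, abs_sub_le_of_shell hη.le hη1 hβ.le pmfMass_nonneg hi hSf.1 hSf.2
      (sampleFraction_mono fun y hy h => ?_) (sampleFraction_mono fun y hy h => ?_)⟩
    · exact (hρ y (List.mem_dedup.2 hy) α (by linarith) (by linarith)).2 hx h
    · exact ((hρ y (List.mem_dedup.2 hy) (α + θ / 2) (by linarith) (by linarith)).1 h).mono
        (by linarith)

end PCondAlg

/-! ### The test of one representative: common error bound -/

open Classical in
/-- The verdict for one representative, as a function of the data that were collected for it. -/
noncomputable def representativeVerdict {N : ℕ} (ε : ℝ) (t : ℕ) (θ w₁ α : ℝ) (S₁ S₂ : List (Fin N))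
    (ρ : Fin N → CompareResult × CompareResult) : Verdict :=
  let w₂ := sampleFraction S₂ fun i => (ρ i).1.Close (α + θ / 2)
  if (w₁ ≤ 3 / 4 * (ε / 100 / t) ∧ 3 / 2 * (ε / 100 / t) < w₂) ∨
      (3 / 4 * (ε / 100 / t) < w₁ ∧
        w₂ / w₁ ∉ Set.Icc (1 - ε / 100 / 2) (1 + ε / 100 / 2)) then
    .reject
  else if ∃ i ∈ S₁ ++ S₂, (ρ i).1.Close (α + ε / 100 / 2) ∧
      ¬ (ρ i).2.Close (α + 3 * (ε / 100) / 2) then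
    .reject
  else .accept

/-- The precision that is used with `t` representatives. -/
noncomputable def testPrecision (ε : ℝ) (t : ℕ) : ℝ :=
  ε / 100 * (ε / 100 / 8) * (ε / 100 / (2 * t)) * (1 / (100 * (t : ℝ))) / 64

theorem testPrecision_pos {ε : ℝ} (hε : 0 < ε) {t : ℕ} (ht : 2 ≤ t) : 0 < testPrecision ε t := by
  have : (2 : ℝ) ≤ t := by exact_mod_cast ht
  unfold testPrecision
  positivity

theorem testPrecision_le {ε : ℝ} (hε : 0 < ε) (hε1 : ε ≤ 1) {t : ℕ} (ht : 2 ≤ t) :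
    testPrecision ε t ≤ ε / 100 / 10 := by
  have ht' : (2 : ℝ) ≤ t := by exact_mod_cast ht
  have h1 : ε / 100 / (2 * t) ≤ 1 := by
    rw [div_le_one (by positivity)]
    linarith
  have h2 : 1 / (100 * (t : ℝ)) ≤ 1 := by
    rw [div_le_one (by positivity)]
    linarith
  calc testPrecision ε t ≤ ε / 100 * (ε / 100 / 8) * 1 * 1 / 64 := by
        unfold testPrecision
        gcongr
    _ ≤ ε / 100 * (1 / 100 / 8) * 1 * 1 / 64 := by gcongr
    _ ≤ _ := by linarith

namespace PCondAlg

variable {N : ℕ} {D : Fin 2 → PMF (Fin N)} {v : ℝ}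

theorem err_compare_both_le {c : SampleConstants} (hc : c.cmp = 10 ^ 6)
    {r : Fin N} {θ δ : ℝ} (hθ : 0 < θ) (hθ1 : θ ≤ 1) (hδ : 0 < δ) (hδ1 : δ ≤ 1 / 2)
    (hv1 : v ≤ 1) (h0 : v = 0 ∨ D 0 r ≠ 0) (h1 : v = 0 ∨ D 1 r ≠ 0) (i : Fin N) :
    err D v (fun z : CompareResult × CompareResult =>
        z.1.Reliable (D 0) r i θ ∧ z.2.Reliable (D 1) r i θ)
      (do
        let a ← pcondCompare c 0 r i (θ / 4) 4 δ
        let b ← pcondCompare c 1 r i (θ / 4) 4 δ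
        pure (a, b)) ≤ δ + δ :=
  err_bind_le hv1 (post_true _ _) (err_pcondCompare_le hc r i hθ hθ1 hδ hδ1 hv1 h0) hδ.le
    fun _ _ ha => err_bind_pure_le hv1 (err_pcondCompare_le hc r i hθ hθ1 hδ hδ1 hv1 h1)
      fun _ hb => ⟨ha, hb⟩

/-- The shared skeleton of completeness and soundness. The events `P₁` and `P₂` may depend on α
because the samples are drawn after α is fixed. The two terms 1/(100t) pay for the neighborhood
estimate and for all comparisons with the points of both samples. -/
theorem err_testRepresentative_le {c : SampleConstants} (hc : c.cmp = 10 ^ 6)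
    (hc' : c.nbh = 10 ^ 4) (hfst : 0 < c.fst) {r : Fin N} (h0 : D 0 r ≠ 0)
    (h1 : v = 0 ∨ D 1 r ≠ 0) (hv0 : 0 ≤ v) (hv1 : v ≤ 1) {ε : ℝ} (hε : 0 < ε) (hε1 : ε ≤ 1)
    {t : ℕ} (ht : 2 ≤ t) {P₁ P₂ : ℝ → List (Fin N) → Prop} {e₁ e₂ : ℝ} (he₁ : 0 ≤ e₁)
    (he₂ : 0 ≤ e₂)
    (hP₁ : ∀ α, err D v (P₁ α) (samples 0 ⌈c.fst * (t / ε ^ 2)⌉₊) ≤ e₁)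
    (hP₂ : ∀ α, err D v (P₂ α) (samples 1 ⌈c.snd * (t * Real.log t / ε ^ 3)⌉₊) ≤ e₂)
    {Q : Verdict → Prop}
    (hQ : ∀ w₁ α S₁ S₂ ρ, ε / 100 ≤ α → α ≤ 2 * (ε / 100) →
      pmfMass (D 0) (NearWeight (α + testPrecision ε t) (D 0) r) ≤
        pmfMass (D 0) (NearWeight α (D 0) r) + ε / 100 / 8 * (ε / 100 / (2 * t)) / 16 →
      |w₁ - pmfMass (D 0) (NearWeight α (D 0) r)| ≤
        ε / 100 / 8 / 4 * (pmfMass (D 0) (NearWeight α (D 0) r) + ε / 100 / (2 * t)) →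
      P₁ α S₁ → P₂ α S₂ →
      (∀ i ∈ S₁ ++ S₂, (ρ i).1.Reliable (D 0) r i (testPrecision ε t) ∧
        (ρ i).2.Reliable (D 1) r i (testPrecision ε t)) →
      Q (representativeVerdict ε t (testPrecision ε t) w₁ α S₁ S₂ ρ)) :
    err D v Q (testRepresentative c ε t r) ≤ 1 / (100 * (t : ℝ)) + (e₁ + (e₂ + 1 / (100 * t))) := by
  classical
  have ht' : (2 : ℝ) ≤ t := by exact_mod_cast ht
  have hθ := testPrecision_pos hε ht
  have hθ1 := testPrecision_le hε hε1 ht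
  set s₁ := ⌈c.fst * (t / ε ^ 2)⌉₊ with hs₁
  set s₂ := ⌈c.snd * (t * Real.log t / ε ^ 3)⌉₊ with hs₂
  have hs₁0 : (1 : ℝ) ≤ s₁ := by
    have : 0 < s₁ := Nat.ceil_pos.2 (by positivity)
    exact_mod_cast this
  have hs₂0 : (0 : ℝ) ≤ s₂ := Nat.cast_nonneg _
  unfold testRepresentative
  dsimp only
  refine err_bind_le hv1 (post_true _ _) (err_estimateNeighborhood_le hc hc' h0 (by positivity)
    (by linarith) (by positivity) ?_ (by positivity) (by linarith) (by positivity) ?_ hv0 hv1)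
    (by positivity) ?_
  · rw [div_le_one (by positivity)]
    linarith
  · rw [div_le_iff₀ (by positivity)]
    linarith
  rintro ⟨w₁, α⟩ - ⟨hα1, hα2, hshell, hw₁⟩
  dsimp only at hα1 hα2 hshell hw₁ ⊢
  refine err_bind_le hv1 (post_samples _ 0 s₁) (hP₁ α) (by positivity) fun S₁ hS₁ hPS₁ => ?_
  refine err_bind_le hv1 (post_samples _ 1 s₂) (hP₂ α) (by positivity) fun S₂ hS₂ hPS₂ => ?_
  have hδ : 1 / (200 * (t : ℝ) * (s₁ + s₂)) ≤ 1 / 2 := by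
    refine one_div_le_one_div_of_le (by norm_num) ?_
    nlinarith
  have htab := err_tabulate_le (D := D) (d := (CompareResult.low, CompareResult.low)) hv1
    (by positivity) (S₁ ++ S₂).dedup fun i _ => err_compare_both_le hc hθ
      (by linarith) (by positivity) hδ hv1 (Or.inr h0) h1 i
  refine err_bind_pure_le hv1 (htab.trans ?_) fun ρ hρ => ?_
  · have hlen : ((S₁ ++ S₂).dedup.length : ℝ) ≤ s₁ + s₂ := by
      rw [← hS₁.1, ← hS₂.1, ← Nat.cast_add, ← List.length_append]
      exact_mod_cast (S₁ ++ S₂).dedup_sublist.length_le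
    refine (mul_le_mul_of_nonneg_right hlen (by positivity)).trans (le_of_eq ?_)
    field_simp
    norm_num
  · exact hQ w₁ α S₁ S₂ ρ hα1 hα2 hshell hw₁ hPS₁ hPS₂ fun i hi => hρ i (List.mem_dedup.2 hi)

end PCondAlg

/-! ### Completeness: equal distributions are accepted -/

theorem abs_sub_le_of_reliable {N : ℕ} {E : PMF (Fin N)} {r : Fin N} {S : List (Fin N)}
    {ρ : Fin N → CompareResult} {α θ : ℝ} (hr : E r ≠ 0) (hα : 0 ≤ α) (hθ : 0 ≤ θ)
    (hαθ : α + θ / 2 ≤ 1 / 2) (h : ∀ i ∈ S, (ρ i).Reliable E r i θ) :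
    sampleFraction S (NearWeight α E r) ≤ sampleFraction S (fun i => (ρ i).Close (α + θ / 2)) ∧
      sampleFraction S (fun i => (ρ i).Close (α + θ / 2)) ≤
        sampleFraction S (NearWeight (α + θ) E r) :=
  ⟨sampleFraction_mono fun i hi h1 => (h i hi α hα (by linarith)).2 hr h1,
    sampleFraction_mono fun i hi h1 =>
      ((h i hi (α + θ / 2) (by linarith) hαθ).1 h1).mono (by linarith)⟩

/-- With β = x/(2t) the thresholds of the weight test are 3β/2 and 3β. Above the first one β ≤ p, so
the additive errors become relative errors of order x; below it both weights are of order β. -/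
theorem ratio_mem_of_abs_sub_le {x β p w₁ w₂ : ℝ} (hx : 0 < x) (hx1 : x ≤ 1 / 100)
    (hβ : 0 < β) (hp : 0 ≤ p) (h1 : |w₁ - p| ≤ x / 8 / 4 * (p + β))
    (h2 : |w₂ - p| ≤ x / 8 / 4 * (p + β)) :
    (w₁ ≤ 3 / 2 * β → w₂ ≤ 3 * β) ∧
      (3 / 2 * β < w₁ → w₂ / w₁ ∈ Set.Icc (1 - x / 2) (1 + x / 2)) := by
  have h3 : x * p ≤ 1 / 100 * p := mul_le_mul_of_nonneg_right hx1 hp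
  have h4 : x * β ≤ 1 / 100 * β := mul_le_mul_of_nonneg_right hx1 hβ.le
  rw [abs_le] at h1 h2
  constructor
  · intro h
    linarith
  · intro h
    have hw : 0 < w₁ := by linarith
    have h5 : β ≤ p := by linarith
    have h6 : x * β ≤ x * p := mul_le_mul_of_nonneg_left h5 hx.le
    have h7 : p ≤ 2 * w₁ := by linarith
    have h8 : x * p ≤ x * (2 * w₁) := mul_le_mul_of_nonneg_left h7 hx.le
    rw [Set.mem_Icc, le_div_iff₀ hw, div_le_iff₀ hw]
    constructor <;> linarith

namespace PCondAlg

variable {N : ℕ} {D : Fin 2 → PMF (Fin N)} {v : ℝ}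

/-- The point is that v is arbitrary: queries to the whole domain never fail, so sampling costs
nothing even when failure counts as an error. -/
theorem err_samples_true (o : Fin 2) (n : ℕ) :
    err D v (fun _ => True) (samples o n) = 0 := by
  unfold err samples
  simp only [if_true]
  induction n with
  | zero => rfl
  | succ n ih =>
    rw [replicate, expect_bind, expect_ask_whole]
    refine Finset.sum_eq_zero fun i _ => ?_
    rw [expect_bind]
    simp only [expect_pure, ih, mul_zero]

theorem err_samples_snd_le {c : SampleConstants} (hsnd : c.snd = 10 ^ 13) {ε : ℝ} (hε : 0 < ε)
    (hε1 : ε ≤ 1)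
    {t : ℕ} (ht : 2 ≤ t) (P : Fin N → Prop) :
    err D v (fun L => |sampleFraction L P - pmfMass (D 1) P| ≤
        ε / 100 / 8 / 16 * (pmfMass (D 1) P + ε / 100 / (2 * t)))
      (samples 1 ⌈c.snd * (t * Real.log t / ε ^ 3)⌉₊) ≤ 1 / (400 * t) := by
  have ht' : (2 : ℝ) ≤ t := by exact_mod_cast ht
  set s := ⌈c.snd * (t * Real.log t / ε ^ 3)⌉₊ with hs
  have hs1 : c.snd * (t * Real.log t / ε ^ 3) ≤ s := Nat.le_ceil _
  have hlog : 0 < Real.log t := Real.log_pos (by linarith)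
  have hl : Real.log (1 / (1 / (400 * (t : ℝ)))) ≤ 10 * Real.log t := by
    rw [show (10 : ℝ) * Real.log t = Real.log ((t : ℝ) ^ 10) by rw [Real.log_pow]; norm_num]
    refine Real.log_le_log (by positivity) ?_
    calc 1 / (1 / (400 * (t : ℝ))) = 400 * t := one_div_one_div _
      _ ≤ 2 ^ 9 * t := by gcongr; norm_num
      _ ≤ (t : ℝ) ^ 9 * t := by gcongr
      _ = (t : ℝ) ^ 10 := by ring
  refine (err_samples_le 1 P (by positivity) ?_ s).trans
    (two_mul_exp_neg_le (by positivity) ?_ ?_)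
  · linarith
  · refine one_div_le_one_div_of_le (by norm_num) (by linarith)
  · calc 2 * Real.log (1 / (1 / (400 * (t : ℝ)))) ≤
          10 ^ 13 * Real.log t / (12800 ^ 2 * 400) := by linarith
      _ = c.snd * (t * Real.log t / ε ^ 3) * (ε / 100 / 8 / 16) ^ 2 * (ε / 100 / (2 * t)) / 2 := by
        rw [hsnd]
        field_simp
        norm_num
      _ ≤ _ := by gcongr

end PCondAlg

theorem representativeVerdict_eq_accept {N : ℕ} {E : PMF (Fin N)} {r : Fin N} {ε : ℝ}
    (hε : 0 < ε) (hε1 : ε ≤ 1) {t : ℕ} (ht : 2 ≤ t) (hr : E r ≠ 0) {w₁ α : ℝ}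
    {S₁ S₂ : List (Fin N)} {ρ : Fin N → CompareResult × CompareResult}
    (hα1 : ε / 100 ≤ α) (hα2 : α ≤ 2 * (ε / 100))
    (hshell : pmfMass E (NearWeight (α + testPrecision ε t) E r) ≤
        pmfMass E (NearWeight α E r) + ε / 100 / 8 * (ε / 100 / (2 * t)) / 16)
    (hw₁ : |w₁ - pmfMass E (NearWeight α E r)| ≤
        ε / 100 / 8 / 4 * (pmfMass E (NearWeight α E r) + ε / 100 / (2 * t)))
    (h1 : |sampleFraction S₂ (NearWeight α E r) - pmfMass E (NearWeight α E r)| ≤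
        ε / 100 / 8 / 16 * (pmfMass E (NearWeight α E r) + ε / 100 / (2 * t)))
    (h2 : |sampleFraction S₂ (NearWeight (α + testPrecision ε t) E r) -
        pmfMass E (NearWeight (α + testPrecision ε t) E r)| ≤
        ε / 100 / 8 / 16 * (pmfMass E (NearWeight (α + testPrecision ε t) E r) +
          ε / 100 / (2 * t)))
    (hρ : ∀ i ∈ S₁ ++ S₂, (ρ i).1.Reliable E r i (testPrecision ε t) ∧
        (ρ i).2.Reliable E r i (testPrecision ε t)) :
    representativeVerdict ε t (testPrecision ε t) w₁ α S₁ S₂ ρ = .accept := by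
  have ht' : (2 : ℝ) ≤ t := by exact_mod_cast ht
  have hθ := testPrecision_pos hε ht
  have hθ1 := testPrecision_le hε hε1 ht
  set θ := testPrecision ε t
  set x := ε / 100 with hx
  have hx0 : 0 < x := by positivity
  have hx1 : x ≤ 1 / 100 := by linarith
  have hxt : x / t = 2 * (x / (2 * t)) := by field_simp
  have hβ0 : 0 < x / (2 * t) := by positivity
  obtain ⟨h3, h4⟩ := abs_sub_le_of_reliable (α := α) (ρ := fun i => (ρ i).1) hr (by linarith) hθ.le
    (by linarith) fun i hi => (hρ i (List.mem_append_right S₁ hi)).1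
  have hw₂ := abs_sub_le_of_shell (by positivity) (by linarith) hβ0.le pmfMass_nonneg
    hshell h1 h2 h3 h4
  obtain ⟨h5, h6⟩ := ratio_mem_of_abs_sub_le hx0 hx1 hβ0 pmfMass_nonneg hw₁ hw₂
  unfold representativeVerdict
  dsimp only
  rw [← hx, hxt, if_neg, if_neg]
  -- Two reliable comparisons lose θ/2 each: closeness α + x/2 under the first copy gives closeness
  -- at most α + x/2 + θ under the second, and θ ≤ x/10 leaves this below α + 3x/2.
  · rintro ⟨i, hi, hc1, hc2⟩
    refine hc2 ?_
    have h7 := ((hρ i hi).1 (α + x / 2) (by linarith) (by linarith)).1 hc1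
    exact (((hρ i hi).2 (α + x / 2 + θ / 2) (by linarith) (by linarith)).2 hr h7).mono
      (by linarith) (by linarith)
  · rintro (⟨h7, h8⟩ | ⟨h7, h8⟩)
    · linarith [h5 (by linarith)]
    · exact h8 (h6 (by linarith))

namespace PCondAlg

variable {N : ℕ} {v : ℝ}

theorem err_testRepresentative_same_le {c : SampleConstants} (hc : c.cmp = 10 ^ 6)
    (hc' : c.nbh = 10 ^ 4) (hfst : 0 < c.fst) (hsnd : c.snd = 10 ^ 13) {E : PMF (Fin N)}
    {r : Fin N} (hr : E r ≠ 0) {ε : ℝ} (hε : 0 < ε) (hε1 : ε ≤ 1) {t : ℕ} (ht : 2 ≤ t) :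
    err ![E, E] 1 (fun a => a = Verdict.accept) (testRepresentative c ε t r) ≤ 1 / (3 * t) := by
  have ht' : (2 : ℝ) ≤ t := by exact_mod_cast ht
  have h := err_testRepresentative_le (D := ![E, E]) (v := 1) hc hc' hfst (r := r) hr (Or.inr hr)
    zero_le_one le_rfl hε hε1 ht (P₁ := fun _ _ => True)
    (P₂ := fun α L => |sampleFraction L (NearWeight α E r) - pmfMass E (NearWeight α E r)| ≤
        ε / 100 / 8 / 16 * (pmfMass E (NearWeight α E r) + ε / 100 / (2 * t)) ∧
      |sampleFraction L (NearWeight (α + testPrecision ε t) E r) -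
        pmfMass E (NearWeight (α + testPrecision ε t) E r)| ≤
        ε / 100 / 8 / 16 * (pmfMass E (NearWeight (α + testPrecision ε t) E r) +
          ε / 100 / (2 * t)))
    (e₁ := 0) (e₂ := 1 / (400 * t) + 1 / (400 * t)) le_rfl (by positivity)
    (fun α => ?_) (fun α => ?_) (Q := fun a => a = Verdict.accept)
    (fun w₁ α S₁ S₂ ρ hα1 hα2 hshell hw₁ _ hP₂ hρ =>
      representativeVerdict_eq_accept hε hε1 ht hr hα1 hα2 hshell hw₁ hP₂.1 hP₂.2 hρ)
  · refine h.trans ?_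
    have : 0 < 1 / (t : ℝ) := by positivity
    have h2 : ∀ k : ℝ, 1 / (k * t) = 1 / k * (1 / t) := fun k => by rw [one_div_mul_one_div]
    simp only [h2]
    linarith
  · exact (err_samples_true _ _).le
  · exact (err_and_le zero_le_one _).trans (add_le_add
      (err_samples_snd_le (D := ![E, E]) hsnd hε hε1 ht _) (err_samples_snd_le (D := ![E, E]) hsnd hε hε1 ht _))

theorem err_testRepresentatives_le {c : SampleConstants} {D : Fin 2 → PMF (Fin N)} {ε : ℝ} {t : ℕ}
    {e : ℝ} (he : 0 ≤ e) (hv1 : v ≤ 1) (R : List (Fin N))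
    (h : ∀ r ∈ R, err D v (fun a => a = Verdict.accept) (testRepresentative c ε t r) ≤ e) :
    err D v (fun a => a = Verdict.accept) (testRepresentatives c ε t R) ≤ R.length * e := by
  induction R with
  | nil =>
    rw [testRepresentatives, err_pure_of (P := fun a => a = Verdict.accept) rfl]
    simp
  | cons r R ih =>
    simp only [List.mem_cons, forall_eq_or_imp] at h
    rw [testRepresentatives, List.length_cons, Nat.cast_succ, add_one_mul, add_comm]
    refine err_bind_le hv1 (post_true _ _) h.1 (by positivity) fun a _ ha => ?_
    subst ha
    exact ih h.2

theorem err_pcondTestEqualityUnknown_same_le {c : SampleConstants} (hc : c.cmp = 10 ^ 6)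
    (hc' : c.nbh = 10 ^ 4) (hfst : 0 < c.fst) (hsnd : c.snd = 10 ^ 13) (E : PMF (Fin N))
    {ε : ℝ} (hε : 0 < ε) (hε1 : ε ≤ 1) (ht : 2 ≤ repSize c N ε) :
    err ![E, E] 1 (fun a => a = Verdict.accept) (pcondTestEqualityUnknown c N ε) ≤ 1 / 3 := by
  unfold pcondTestEqualityUnknown
  set t := repSize c N ε
  have ht' : (2 : ℝ) ≤ t := by exact_mod_cast ht
  rw [← zero_add (1 / 3 : ℝ)]
  refine err_bind_le (P := fun _ => True) le_rfl (post_samples _ 0 t) ?_ (by norm_num) fun R hR _ => ?_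
  · exact (err_samples_true _ _).le
  · refine (err_testRepresentatives_le (e := 1 / (3 * t)) (by positivity) le_rfl R fun r hr =>
      err_testRepresentative_same_le hc hc' hfst hsnd (hR.2 r hr) hε hε1 ht).trans (le_of_eq ?_)
    rw [hR.1]
    field_simp

end PCondAlg

/-! ### Soundness for a representative in a deficient bucket -/

/-- If the weights of two distributions are roughly constant on a set, and if the second
distribution gives it roughly as much mass as the first, then the weights are close. -/
theorem deficit_le_of_mass_le {N : ℕ} {D₁ D₂ : PMF (Fin N)} {r i : Fin N} {x p : ℝ}
    {W : Fin N → Prop} (hx : 0 < x) (hx1 : x ≤ 1 / 100) (hrW : W r)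
    (hW₁ : ∀ j, W j → NearWeight (3 * x) D₁ r j) (hW₂ : ∀ j, W j → NearWeight (4 * x) D₂ r j)
    (h₁ : pmfMass D₁ W ≤ p) (h₂ : (1 - 5 * x) * p ≤ pmfMass D₂ W)
    (hi : W i) (hir : NearWeight x D₁ r i) :
    (1 - 50 * x) * (D₁ i).toReal ≤ (D₂ i).toReal := by
  classical
  set a := (D₁ r).toReal with ha
  set b := (D₂ r).toReal with hb
  have ha0 : 0 ≤ a := ENNReal.toReal_nonneg
  have hb0 : 0 ≤ b := ENNReal.toReal_nonneg
  have hd1 : 0 ≤ (D₁ i).toReal := ENNReal.toReal_nonneg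
  have hd2 : 0 ≤ (D₂ i).toReal := ENNReal.toReal_nonneg
  have hcard : ∀ y : ℝ, ∑ j, (if W j then y else 0) = (Finset.univ.filter W).card * y := by
    intro y
    rw [← Finset.sum_filter, Finset.sum_const, nsmul_eq_mul]
  set n : ℝ := ((Finset.univ.filter W).card : ℝ) with hn
  have hn0 : 0 < n := by
    have : 0 < (Finset.univ.filter W).card := Finset.card_pos.2 ⟨r, by simpa using hrW⟩
    rw [hn]
    exact_mod_cast this
  -- Both masses of W are compared with the number n of its points times the weight of r. Cancelling
  -- n turns the comparison of masses into one of D₁(r) with D₂(r).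
  have hm₁ : n * a ≤ (1 + 3 * x) * pmfMass D₁ W := by
    rw [← hcard, pmfMass, Finset.mul_sum]
    refine Finset.sum_le_sum fun j _ => ?_
    split_ifs with hj
    · exact (hW₁ j hj).2
    · simp
  have hm₂ : pmfMass D₂ W ≤ n * ((1 + 4 * x) * b) := by
    rw [← hcard, pmfMass]
    refine Finset.sum_le_sum fun j _ => ?_
    split_ifs with hj
    · exact (hW₂ j hj).1
    · exact le_rfl
  have h3 : (1 - 5 * x) * a ≤ (1 + 3 * x) * ((1 + 4 * x) * b) := by
    refine le_of_mul_le_mul_left ?_ hn0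
    have e1 : n * a ≤ (1 + 3 * x) * p :=
      hm₁.trans (mul_le_mul_of_nonneg_left h₁ (by linarith))
    have e2 : (1 - 5 * x) * (n * a) ≤ (1 - 5 * x) * ((1 + 3 * x) * p) :=
      mul_le_mul_of_nonneg_left e1 (by linarith)
    have e3 : (1 + 3 * x) * ((1 - 5 * x) * p) ≤ (1 + 3 * x) * (n * ((1 + 4 * x) * b)) :=
      mul_le_mul_of_nonneg_left (h₂.trans hm₂) (by linarith)
    linarith
  have h4 : (1 - 5 * x) * (D₁ i).toReal ≤ (1 - 5 * x) * ((1 + x) * a) :=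
    mul_le_mul_of_nonneg_left hir.1 (by linarith)
  have h5 : (1 + x) * ((1 + 3 * x) * (1 + 4 * x)) * b ≤
      (1 + x) * ((1 + 3 * x) * (1 + 4 * x)) * ((1 + 4 * x) * (D₂ i).toReal) :=
    mul_le_mul_of_nonneg_left (hW₂ i hi).2 (by positivity)
  have h6 : (1 - 5 * x) * (D₁ i).toReal ≤
      (1 + x) * ((1 + 3 * x) * (1 + 4 * x)) * ((1 + 4 * x) * (D₂ i).toReal) := by
    have := mul_le_mul_of_nonneg_left h3 (by linarith : 0 ≤ 1 + x)
    linarith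
  -- The accumulated factor is 1 + 12x to first order; for x ≤ 1/100 the higher terms fit into
  -- another x. The final constant 50 is generous.
  have h7 : (1 + x) * ((1 + 3 * x) * (1 + 4 * x)) * (1 + 4 * x) ≤ 1 + 13 * x := by
    have e1 : x * x ≤ 1 / 100 * x := mul_le_mul_of_nonneg_right hx1 hx.le
    have e2 : x * (x * x) ≤ 1 / 100 * (x * x) := mul_le_mul_of_nonneg_right hx1 (by positivity)
    have e3 : x * (x * (x * x)) ≤ 1 / 100 * (x * (x * x)) :=
      mul_le_mul_of_nonneg_right hx1 (by positivity)
    nlinarith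
  have h8 : (1 - 5 * x) * (D₁ i).toReal ≤ (1 + 13 * x) * (D₂ i).toReal := by
    have := mul_le_mul_of_nonneg_right h7 hd2
    linarith
  have h9 : (1 + 13 * x) * (1 - 50 * x) ≤ 1 - 5 * x := by nlinarith
  refine le_of_mul_le_mul_left ?_ (by linarith : 0 < 1 + 13 * x)
  have := mul_le_mul_of_nonneg_right h9 hd1
  linarith

/-- Here q is the D₂-mass of the outer neighborhood and A the part of it that is also near r under
D₂. Every loss is of order x p: the two estimation errors because β ≤ p/10, the ratio test, and the
discarded part because τ ≤ x p. -/
theorem mass_lower_bound {x β p w₁ w₂ q A τ : ℝ} (hx : 0 < x) (hx1 : x ≤ 1 / 100)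
    (hβ : 0 < β) (hp : 10 * β ≤ p) (hτ : τ ≤ x * p)
    (hw₁ : |w₁ - p| ≤ x / 8 / 4 * (p + β))
    (hw₂ : w₂ ≤ q + x / 8 / 16 * (q + β)) (hq : q ≤ A + τ)
    (hw : (1 - x / 2) * w₁ ≤ w₂) : (1 - 4 * x) * p ≤ A := by
  have hp0 : 0 < p := by linarith
  have hxp : 0 < x * p := mul_pos hx hp0
  have e1 : x * (x * p) ≤ 1 / 100 * (x * p) := mul_le_mul_of_nonneg_right hx1 hxp.le
  have e0 : x * (10 * β) ≤ x * p := mul_le_mul_of_nonneg_left hp hx.le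
  have h1 : (1 - x / 20) * p ≤ w₁ := by
    have := (abs_le.1 hw₁).1
    nlinarith
  have h2 : (1 - x / 2) * ((1 - x / 20) * p) ≤ w₂ :=
    (mul_le_mul_of_nonneg_left h1 (by linarith)).trans hw
  have h3 : (1 + x / 128) * q ≤ (1 + x / 128) * (A + x * p) :=
    mul_le_mul_of_nonneg_left (hq.trans (by linarith)) (by linarith)
  refine le_of_mul_le_mul_left ?_ (by linarith : 0 < 1 + x / 128)
  have e2 : 0 ≤ x * (x * p) := by positivity
  have h4 : (1 - x / 2) * ((1 - x / 20) * p) ≤ (1 + x / 128) * (A + x * p) + x * p / 1280 := by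
    linarith
  nlinarith

/-- By contradiction from an acceptance. Since only deficits of D₂ matter, just the upper half of
the sandwich for w₂ and the lower end of the ratio test are used. The lower bound on p ensures that
the ratio test is active. -/
theorem representativeVerdict_eq_reject {N : ℕ} {D₁ D₂ : PMF (Fin N)} {r : Fin N} {ε : ℝ}
    (hε : 0 < ε) (hε1 : ε ≤ 1) {t : ℕ} (ht : 2 ≤ t) (hr : D₁ r ≠ 0) {w₁ α τ : ℝ}
    {S₁ S₂ : List (Fin N)} {ρ : Fin N → CompareResult × CompareResult}
    (hα1 : ε / 100 ≤ α) (hα2 : α ≤ 2 * (ε / 100))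
    (hshell : pmfMass D₁ (NearWeight (α + testPrecision ε t) D₁ r) ≤
        pmfMass D₁ (NearWeight α D₁ r) + ε / 100 / 8 * (ε / 100 / (2 * t)) / 16)
    (hw₁ : |w₁ - pmfMass D₁ (NearWeight α D₁ r)| ≤
        ε / 100 / 8 / 4 * (pmfMass D₁ (NearWeight α D₁ r) + ε / 100 / (2 * t)))
    (h2 : |sampleFraction S₂ (NearWeight (α + testPrecision ε t) D₁ r) -
        pmfMass D₂ (NearWeight (α + testPrecision ε t) D₁ r)| ≤
        ε / 100 / 8 / 16 * (pmfMass D₂ (NearWeight (α + testPrecision ε t) D₁ r) +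
          ε / 100 / (2 * t)))
    (hρ : ∀ i ∈ S₁ ++ S₂, (ρ i).1.Reliable D₁ r i (testPrecision ε t) ∧
        (ρ i).2.Reliable D₂ r i (testPrecision ε t))
    (hhit₁ : pmfMass D₁ (fun i => NearWeight (α + testPrecision ε t) D₁ r i ∧
      ¬ NearWeight (α + 2 * (ε / 100)) D₂ r i) ≤ τ ∨
      ∃ i ∈ S₁, NearWeight (α + testPrecision ε t) D₁ r i ∧
        ¬ NearWeight (α + 2 * (ε / 100)) D₂ r i)
    (hhit₂ : pmfMass D₂ (fun i => NearWeight (α + testPrecision ε t) D₁ r i ∧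
      ¬ NearWeight (α + 2 * (ε / 100)) D₂ r i) ≤ τ ∨
      ∃ i ∈ S₂, NearWeight (α + testPrecision ε t) D₁ r i ∧
        ¬ NearWeight (α + 2 * (ε / 100)) D₂ r i)
    (hp : 10 * (ε / 100 / (2 * t)) ≤ pmfMass D₁ (NearWeight (ε / 100) D₁ r))
    (hτ : τ ≤ ε / 100 * pmfMass D₁ (NearWeight (ε / 100) D₁ r))
    (hdef : τ < pmfMass D₁ fun i => NearWeight (ε / 100) D₁ r i ∧
      (D₂ i).toReal < (1 - 50 * (ε / 100)) * (D₁ i).toReal) :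
    representativeVerdict ε t (testPrecision ε t) w₁ α S₁ S₂ ρ = .reject := by
  have ht' : (2 : ℝ) ≤ t := by exact_mod_cast ht
  have hθ := testPrecision_pos hε ht
  have hθ1 := testPrecision_le hε hε1 ht
  by_contra hne
  unfold representativeVerdict at hne
  dsimp only at hne
  set θ := testPrecision ε t
  set x := ε / 100 with hx
  have hx0 : 0 < x := by positivity
  have hx1 : x ≤ 1 / 100 := by linarith
  have hxt : x / t = 2 * (x / (2 * t)) := by field_simp
  have hβ0 : 0 < x / (2 * t) := by positivity
  split_ifs at hne with hc1 hc2
  · exact hne rfl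
  · exact hne rfl
  push Not at hc1 hc2
  -- No sampled point is bad. Near within α + θ under D₁ is reported close within α + 3θ/2 ≤ α +
  -- x/2, so the second check applies and its bound α + 3x/2 yields nearness α + 3x/2 + θ/2 ≤ α + 2x
  -- under D₂.
  have hno : ∀ i ∈ S₁ ++ S₂, NearWeight (α + θ) D₁ r i → NearWeight (α + 2 * x) D₂ r i := by
    intro i hi hn
    have e1 := (((hρ i hi).1 (α + θ) (by linarith) (by linarith)).2 hr hn).mono
      (by linarith) (by linarith : α + θ + θ / 2 ≤ α + x / 2)
    exact (((hρ i hi).2 (α + 3 * x / 2) (by linarith) (by linarith)).1 (hc2 i hi e1)).mono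
      (by linarith)
  have hA₁ := hhit₁.resolve_right (by
    rintro ⟨i, hi, h3, h4⟩
    exact h4 (hno i (List.mem_append_left _ hi) h3))
  have hA₂ := hhit₂.resolve_right (by
    rintro ⟨i, hi, h3, h4⟩
    exact h4 (hno i (List.mem_append_right _ hi) h3))
  have hmono : pmfMass D₁ (NearWeight x D₁ r) ≤ pmfMass D₁ (NearWeight α D₁ r) :=
    pmfMass_mono fun i hi => hi.mono hα1
  have hw₂ := (abs_sub_le_of_reliable (α := α) (ρ := fun i => (ρ i).1) hr (by linarith) hθ.le
    (by linarith) fun i hi => (hρ i (List.mem_append_right S₁ hi)).1).2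
  obtain ⟨p, hpdef⟩ : ∃ p, p = pmfMass D₁ (NearWeight α D₁ r) := ⟨_, rfl⟩
  rw [← hpdef] at hw₁ hshell hmono
  have hp' : 10 * (x / (2 * t)) ≤ p := hp.trans hmono
  have hw₁l : 3 / 2 * (x / (2 * t)) < w₁ := by
    have e1 := (abs_le.1 hw₁).1
    have e2 : x * p ≤ 1 / 100 * p := mul_le_mul_of_nonneg_right hx1 (by linarith)
    have e3 : x * (x / (2 * t)) ≤ 1 / 100 * (x / (2 * t)) :=
      mul_le_mul_of_nonneg_right hx1 hβ0.le
    linarith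
  have hrat := (hc1.2 (by rw [hxt]; linarith)).1
  rw [le_div_iff₀ (by linarith)] at hrat
  have hmain := mass_lower_bound (τ := τ) (q := pmfMass D₂ (NearWeight (α + θ) D₁ r))
    (A := pmfMass D₂ fun i => NearWeight (α + θ) D₁ r i ∧ NearWeight (α + 2 * x) D₂ r i)
    hx0 hx1 hβ0 hp' (hτ.trans (mul_le_mul_of_nonneg_left hmono hx0.le)) hw₁
    (hw₂.trans (by linarith [(abs_le.1 h2).2])) (by
      refine (pmfMass_le_add fun i hi => ?_).trans (add_le_add le_rfl hA₂)
      by_cases h : NearWeight (α + 2 * x) D₂ r i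
      · exact Or.inl ⟨hi, h⟩
      · exact Or.inr ⟨hi, h⟩) hrat
  -- Every deficient x-near point must be bad: a point that is not bad lies in W, where counting
  -- excludes a deficit. The bad set has D₁-mass at most τ.
  refine absurd hdef (not_lt.2 ((pmfMass_mono ?_).trans hA₁))
  rintro i ⟨hi1, hi2⟩
  refine ⟨hi1.mono (by linarith), fun hi3 => absurd hi2 (not_lt.2 ?_)⟩
  refine deficit_le_of_mass_le
    (W := fun i => NearWeight (α + θ) D₁ r i ∧ NearWeight (α + 2 * x) D₂ r i)
    (p := p + x / 8 * (x / (2 * t)) / 16) hx0 hx1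
    ⟨nearWeight_self (by linarith) _ _, nearWeight_self (by linarith) _ _⟩
    (fun j hj => hj.1.mono (by linarith)) (fun j hj => hj.2.mono (by linarith))
    ((pmfMass_mono fun j hj => hj.1).trans hshell) ?_ ⟨hi1.mono (by linarith), hi3⟩ hi1
  refine le_trans ?_ hmain
  have e1 : x * (10 * (x / (2 * t))) ≤ x * p := mul_le_mul_of_nonneg_left hp' hx0.le
  have e2 : 0 ≤ x * (x * (x / (2 * t))) := by positivity
  nlinarith

namespace PCondAlg

variable {N : ℕ}

theorem err_testRepresentative_far_le {c : SampleConstants} (hc : c.cmp = 10 ^ 6)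
    (hc' : c.nbh = 10 ^ 4) (hfst : 0 < c.fst) (hsnd : c.snd = 10 ^ 13) {D₁ D₂ : PMF (Fin N)}
    {r : Fin N} (hr : D₁ r ≠ 0) {ε : ℝ} (hε : 0 < ε) (hε1 : ε ≤ 1) {t : ℕ} (ht : 2 ≤ t) {τ : ℝ}
    (hs₁ : 320 ≤ c.fst * (t / ε ^ 2) * τ) (hs₂ : 320 ≤ c.snd * (t * Real.log t / ε ^ 3) * τ)
    (hτ0 : 0 ≤ τ)
    (hp : 10 * (ε / 100 / (2 * t)) ≤ pmfMass D₁ (NearWeight (ε / 100) D₁ r))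
    (hτ : τ ≤ ε / 100 * pmfMass D₁ (NearWeight (ε / 100) D₁ r))
    (hdef : τ < pmfMass D₁ fun i => NearWeight (ε / 100) D₁ r i ∧
      (D₂ i).toReal < (1 - 50 * (ε / 100)) * (D₁ i).toReal) :
    err ![D₁, D₂] 0 (fun a => a = Verdict.reject) (testRepresentative c ε t r) ≤ 1 / 10 := by
  have ht' : (2 : ℝ) ≤ t := by exact_mod_cast ht
  -- The bound 320/32 = 10 suffices since 2 log 50 ≤ 10, which follows from 2.7⁵ ≥ 50.
  have hexp : ∀ z : ℝ, 320 ≤ z → 2 * Real.exp (-(z / 32)) ≤ 1 / 50 := by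
    intro z hz
    refine (two_mul_exp_neg_le (by norm_num) (by norm_num) ?_)
    have h1 : Real.log (1 / (1 / 50)) ≤ 5 := by
      rw [one_div_one_div, Real.log_le_iff_le_exp (by norm_num)]
      have h3 : (2.7 : ℝ) ^ 5 ≤ Real.exp 1 ^ 5 := by
        gcongr
        linarith [Real.exp_one_gt_d9]
      rw [← Real.exp_nat_mul] at h3
      norm_num at h3 ⊢
      linarith
    linarith
  have h := err_testRepresentative_le (D := ![D₁, D₂]) (v := 0) hc hc' hfst (r := r) hr
    (Or.inl rfl) le_rfl zero_le_one hε hε1 ht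
    (P₁ := fun α L => pmfMass D₁ (fun i => NearWeight (α + testPrecision ε t) D₁ r i ∧
        ¬ NearWeight (α + 2 * (ε / 100)) D₂ r i) ≤ τ ∨
      ∃ i ∈ L, NearWeight (α + testPrecision ε t) D₁ r i ∧
        ¬ NearWeight (α + 2 * (ε / 100)) D₂ r i)
    (P₂ := fun α L => |sampleFraction L (NearWeight (α + testPrecision ε t) D₁ r) -
        pmfMass D₂ (NearWeight (α + testPrecision ε t) D₁ r)| ≤
        ε / 100 / 8 / 16 * (pmfMass D₂ (NearWeight (α + testPrecision ε t) D₁ r) +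
          ε / 100 / (2 * t)) ∧
      (pmfMass D₂ (fun i => NearWeight (α + testPrecision ε t) D₁ r i ∧
        ¬ NearWeight (α + 2 * (ε / 100)) D₂ r i) ≤ τ ∨
      ∃ i ∈ L, NearWeight (α + testPrecision ε t) D₁ r i ∧
        ¬ NearWeight (α + 2 * (ε / 100)) D₂ r i))
    (e₁ := 1 / 50) (e₂ := 1 / (400 * t) + 1 / 50) (by norm_num) (by positivity)
    (fun α => ?_) (fun α => ?_) (Q := fun a => a = Verdict.reject)
    (fun w₁ α S₁ S₂ ρ hα1 hα2 hshell hw₁ hP₁ hP₂ hρ =>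
      representativeVerdict_eq_reject hε hε1 ht hr hα1 hα2 hshell hw₁ hP₂.1 hρ hP₁ hP₂.2
        hp hτ hdef)
  · refine h.trans ?_
    have h1 : 1 / (t : ℝ) ≤ 1 / 2 := one_div_le_one_div_of_le (by norm_num) ht'
    have h2 : ∀ k : ℝ, 1 / (k * t) = 1 / k * (1 / t) := fun k => by rw [one_div_mul_one_div]
    simp only [h2]
    linarith
  · refine (err_hit_le (D := ![D₁, D₂]) 0 _ _).trans (hexp _ (hs₁.trans ?_))
    exact mul_le_mul_of_nonneg_right (Nat.le_ceil _) hτ0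
  · refine (err_and_le le_rfl _).trans (add_le_add
      (err_samples_snd_le (D := ![D₁, D₂]) hsnd hε hε1 ht _)
      ((err_hit_le (D := ![D₁, D₂]) 1 _ _).trans (hexp _ (hs₂.trans ?_))))
    exact mul_le_mul_of_nonneg_right (Nat.le_ceil _) hτ0

end PCondAlg

/-! ### Geometric buckets and the number of representatives -/

theorem pmfMass_le_sum {N : ℕ} {D : PMF (Fin N)} {P : Fin N → Prop} {Q : ℕ → Fin N → Prop} {b : ℕ}
    (h : ∀ i, P i → ∃ k < b, Q k i) : pmfMass D P ≤ ∑ k ∈ Finset.range b, pmfMass D (Q k) := by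
  classical
  unfold pmfMass
  rw [Finset.sum_comm]
  refine Finset.sum_le_sum fun i _ => ?_
  have h0 : ∀ k ∈ Finset.range b, (0 : ℝ) ≤ if Q k i then (D i).toReal else 0 :=
    fun k _ => by split_ifs <;> simp
  split_ifs with hP
  · obtain ⟨k, hk, hQ⟩ := h i hP
    refine le_trans ?_ (Finset.single_le_sum h0 (Finset.mem_range.2 hk))
    simp [hQ]
  · exact Finset.sum_nonneg h0

/-- The distance is the sum of the positive parts of D₁ - D₂. Such a part is at most y D₁(i) unless
i has a deficit, and then it is at most D₁(i). -/
theorem pmfTVDist_le {N : ℕ} (D₁ D₂ : PMF (Fin N)) {y : ℝ} (hy : 0 ≤ y) :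
    pmfTVDist D₁ D₂ ≤
      y + pmfMass D₁ fun i => (D₂ i).toReal < (1 - y) * (D₁ i).toReal := by
  classical
  have h1 : ∑ i, ((D₁ i).toReal - (D₂ i).toReal) = 0 := by
    rw [Finset.sum_sub_distrib, pmf_sum_toReal, pmf_sum_toReal, sub_self]
  have h2 : y = ∑ i, y * (D₁ i).toReal := by rw [← Finset.mul_sum, pmf_sum_toReal, mul_one]
  have h3 : pmfTVDist D₁ D₂ = ∑ i, (1 / 2) * (|(D₁ i).toReal - (D₂ i).toReal| +
      ((D₁ i).toReal - (D₂ i).toReal)) := by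
    rw [← Finset.mul_sum, Finset.sum_add_distrib, h1, add_zero, pmfTVDist]
  rw [h3]
  nth_rw 1 [h2]
  unfold pmfMass
  rw [← Finset.sum_add_distrib]
  refine Finset.sum_le_sum fun i _ => ?_
  have ha : 0 ≤ (D₁ i).toReal := ENNReal.toReal_nonneg
  have hb : 0 ≤ (D₂ i).toReal := ENNReal.toReal_nonneg
  have hya : 0 ≤ y * (D₁ i).toReal := mul_nonneg hy ha
  rcases abs_cases ((D₁ i).toReal - (D₂ i).toReal) with ⟨h, _⟩ | ⟨h, _⟩ <;> rw [h] <;>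
    split_ifs with hd <;> linarith

/-- If the distributions are far from each other, then some set on which the weights of the first
one are nearly constant contains many points to which the second one gives less weight. -/
theorem exists_deficit_bucket {N : ℕ} {D₁ D₂ : PMF (Fin N)} {x : ℝ} (hN : 0 < N) (hx : 0 < x)
    {b : ℕ} (hb : (N : ℝ) / x < (1 + x) ^ b) (hd : 100 * x ≤ pmfTVDist D₁ D₂) :
    ∃ B : Fin N → Prop, (∀ r, B r → D₁ r ≠ 0) ∧ (∀ r i, B r → B i → NearWeight x D₁ r i) ∧
      48 * x / b ≤ pmfMass D₁ fun i => B i ∧ (D₂ i).toReal < (1 - 50 * x) * (D₁ i).toReal := by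
  have hN' : (0 : ℝ) < N := by exact_mod_cast hN
  set a := x / N with ha
  have ha0 : 0 < a := by positivity
  -- The buckets start at x/N, so lighter points have total mass at most x, and b of them reach past
  -- weight 1. If every bucket had deficit mass below 48x/b, the distance would be at most 50x + x +
  -- 48x < 100x.
  let B : ℕ → Fin N → Prop := fun k i =>
    a * (1 + x) ^ k ≤ (D₁ i).toReal ∧ (D₁ i).toReal ≤ a * (1 + x) ^ (k + 1)
  have hBpos : ∀ k r, B k r → 0 < (D₁ r).toReal := fun k r hr =>
    lt_of_lt_of_le (by positivity) hr.1
  by_contra! hno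
  have hB : ∀ k, pmfMass D₁ (fun i => B k i ∧ (D₂ i).toReal < (1 - 50 * x) * (D₁ i).toReal) <
      48 * x / b := by
    refine fun k => hno (B k) (fun r hr h0 => ?_) fun r i hr hi => ⟨?_, ?_⟩
    · have := hBpos k r hr
      simp [h0] at this
    · calc (D₁ i).toReal ≤ a * (1 + x) ^ (k + 1) := hi.2
        _ = (1 + x) * (a * (1 + x) ^ k) := by ring
        _ ≤ _ := mul_le_mul_of_nonneg_left hr.1 (by positivity)
    · calc (D₁ r).toReal ≤ a * (1 + x) ^ (k + 1) := hr.2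
        _ = (1 + x) * (a * (1 + x) ^ k) := by ring
        _ ≤ _ := mul_le_mul_of_nonneg_left hi.1 (by positivity)
  have h1 := pmfTVDist_le D₁ D₂ (y := 50 * x) (by positivity)
  have h2 : pmfMass D₁ (fun i => (D₁ i).toReal < a) ≤ x := by
    classical
    calc pmfMass D₁ (fun i => (D₁ i).toReal < a) ≤ ∑ _i : Fin N, a := by
          refine Finset.sum_le_sum fun i _ => ?_
          split_ifs with h
          · exact h.le
          · exact ha0.le
      _ = x := by
          rw [Finset.sum_const, Finset.card_univ, Fintype.card_fin, nsmul_eq_mul, ha]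
          field_simp
  have h3 : pmfMass D₁ (fun i => ∃ k < b, B k i ∧
      (D₂ i).toReal < (1 - 50 * x) * (D₁ i).toReal) ≤ 48 * x := by
    refine (pmfMass_le_sum (Q := fun k i => B k i ∧
      (D₂ i).toReal < (1 - 50 * x) * (D₁ i).toReal) fun i hi => hi).trans ?_
    refine (Finset.sum_le_sum fun k _ => (hB k).le).trans ?_
    rw [Finset.sum_const, Finset.card_range, nsmul_eq_mul]
    rcases Nat.eq_zero_or_pos b with h0 | h0
    · simp only [h0, Nat.cast_zero, zero_mul]
      positivity
    · field_simp
      exact le_rfl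
  have h4 := pmfMass_le_add (D := D₁) (P := fun i => (D₂ i).toReal < (1 - 50 * x) * (D₁ i).toReal)
    (Q := fun i => (D₁ i).toReal < a) (R := fun i => ∃ k < b, B k i ∧
      (D₂ i).toReal < (1 - 50 * x) * (D₁ i).toReal) fun i hi => by
    by_cases hia : (D₁ i).toReal < a
    · exact Or.inl hia
    · right
      push Not at hia
      obtain ⟨k, hk1, hk2⟩ := exists_nat_pow_near ((one_le_div ha0).2 hia)
        (by linarith : 1 < 1 + x)
      rw [le_div_iff₀ ha0, mul_comm] at hk1
      rw [div_lt_iff₀ ha0, mul_comm] at hk2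
      refine ⟨k, ?_, ⟨hk1, hk2.le⟩, hi⟩
      by_contra! hbk
      have h5 : (1 + x) ^ b ≤ (1 + x) ^ k := pow_le_pow_right₀ (by linarith) hbk
      have h6 : a * (N / x) < (D₁ i).toReal :=
        (mul_lt_mul_of_pos_left (hb.trans_le h5) ha0).trans_le hk1
      rw [ha, div_mul_div_cancel₀ hN'.ne', div_self hx.ne'] at h6
      have h7 : (D₁ i).toReal ≤ 1 := by
        rw [← ENNReal.toReal_one]
        exact ENNReal.toReal_mono ENNReal.one_ne_top (PMF.coe_le_one _ _)
      linarith
  linarith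

theorem exists_bucket_number {N : ℕ} (hN : 0 < N) {x : ℝ} (hx : 0 < x) (hx1 : x ≤ 1) :
    ∃ b : ℕ, 0 < b ∧ (N : ℝ) / x < (1 + x) ^ b ∧ (b : ℝ) ≤ 2 / x * Real.log (N / x) + 2 := by
  have hN' : (1 : ℝ) ≤ N := by exact_mod_cast hN
  have hlog : 0 ≤ Real.log (N / x) := Real.log_nonneg (by rw [le_div_iff₀ hx]; linarith)
  refine ⟨⌈2 / x * Real.log (N / x)⌉₊ + 1, Nat.succ_pos _, ?_, ?_⟩
  · set b := ⌈2 / x * Real.log (N / x)⌉₊ + 1 with hb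
    have h1 : 2 / x * Real.log (N / x) < b := by
      rw [hb, Nat.cast_succ]
      linarith [Nat.le_ceil (2 / x * Real.log (N / x))]
    -- From exp(-x/2) ≥ 1 - x/2 and (1 - x/2)(1 + x) ≥ 1 for 0 < x ≤ 1. Hence b > (2/x) log(N/x)
    -- makes (1 + x)^b exceed N/x.
    have h2 : Real.exp (x / 2) ≤ 1 + x := by
      have h3 := Real.one_sub_le_exp_neg (x / 2)
      rw [Real.exp_neg, ← one_div, le_div_iff₀ (Real.exp_pos _)] at h3
      have h4 : (1 - x / 2) * Real.exp (x / 2) ≤ (1 - x / 2) * (1 + x) := by nlinarith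
      exact le_of_mul_le_mul_left h4 (by linarith)
    calc (N : ℝ) / x = Real.exp (Real.log (N / x)) := (Real.exp_log (by positivity)).symm
      _ < Real.exp (b * (x / 2)) := by
        rw [Real.exp_lt_exp]
        have := mul_lt_mul_of_pos_right h1 (by positivity : 0 < x / 2)
        rwa [show 2 / x * Real.log (N / x) * (x / 2) = Real.log (N / x) by field_simp] at this
      _ = Real.exp (x / 2) ^ b := Real.exp_nat_mul _ _
      _ ≤ (1 + x) ^ b := by gcongr
  · push_cast
    linarith [(Nat.ceil_lt_add_one (by positivity : 0 ≤ 2 / x * Real.log (N / x))).le]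

/-- The second logarithm in the definition of t enters correctness only through the lower bound 1/4;
the constant 2500000 is 10⁷/4. -/
theorem le_repSize {c : SampleConstants} (hrep : c.rep = 10 ^ 7) {N : ℕ} (hN : 0 < N) {ε : ℝ}
    (hε : 0 < ε) (hε1 : ε ≤ 1) :
    2500000 * (Real.log (2 * N / ε) / ε ^ 2) ≤ repSize c N ε ∧ 2 ≤ repSize c N ε := by
  have hN' : (1 : ℝ) ≤ N := by exact_mod_cast hN
  have hL : 0.69 ≤ Real.log (2 * N / ε) := by
    have h1 : (2 : ℝ) ≤ 2 * N / ε := by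
      rw [le_div_iff₀ hε]
      nlinarith
    linarith [Real.log_two_gt_d9, Real.log_le_log (by norm_num) h1]
  set L := Real.log (2 * N / ε)
  have hL2 : 1 / 4 ≤ Real.log (2 * L / ε) := by
    have h1 : 1.38 ≤ 2 * L / ε := by
      rw [le_div_iff₀ hε]
      nlinarith
    have h2 := Real.one_sub_inv_le_log_of_pos (by linarith : 0 < 2 * L / ε)
    have h3 : (2 * L / ε)⁻¹ ≤ 1.38⁻¹ := inv_anti₀ (by norm_num) h1
    have h4 : (1.38 : ℝ)⁻¹ ≤ 0.73 := by norm_num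
    linarith
  have h1 : 2500000 * (L / ε ^ 2) ≤ repSize c N ε := by
    refine le_trans ?_ (Nat.le_ceil _)
    rw [hrep]
    have h2 : 0 ≤ L / ε ^ 2 := by positivity
    nlinarith [mul_le_mul_of_nonneg_left hL2 h2]
  refine ⟨h1, ?_⟩
  have h2 : L ≤ L / ε ^ 2 := by
    rw [le_div_iff₀ (by positivity)]
    have : ε ^ 2 ≤ 1 := pow_le_one₀ hε.le hε1
    nlinarith
  have h3 : (2 : ℝ) ≤ repSize c N ε := by linarith
  exact_mod_cast h3

theorem bucket_number_le_repSize {c : SampleConstants} (hrep : c.rep = 10 ^ 7) {N : ℕ}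
    (hN : 0 < N) {ε : ℝ} (hε : 0 < ε) (hε1 : ε ≤ 1) {b : ℝ}
    (hb : b ≤ 2 / (ε / 100) * Real.log (N / (ε / 100)) + 2) :
    10 * b ≤ ε / 100 * repSize c N ε := by
  have hN' : (1 : ℝ) ≤ N := by exact_mod_cast hN
  have h1 := (le_repSize hrep hN hε hε1).1
  have h2 : Real.log 2 ≤ Real.log (2 * N / ε) := by
    refine Real.log_le_log (by norm_num) ?_
    rw [le_div_iff₀ hε]
    nlinarith
  have h3 : Real.log (N / (ε / 100)) ≤ 7 * Real.log (2 * N / ε) := by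
    have h4 : Real.log (N / (ε / 100)) ≤ Real.log (2 ^ 6 * (2 * N / ε)) := by
      refine Real.log_le_log (by positivity) ?_
      rw [show (N : ℝ) / (ε / 100) = 50 * (2 * N / ε) by field_simp; norm_num]
      gcongr
      norm_num
    rw [Real.log_mul (by norm_num) (by positivity), Real.log_pow] at h4
    push_cast at h4
    linarith
  set L := Real.log (2 * N / ε)
  have hL : 0.69 ≤ L := by linarith [Real.log_two_gt_d9]
  have h5 : 2 ≤ 3 * (L / ε) := by
    rw [mul_div, le_div_iff₀ hε]
    nlinarith
  have h6 : b ≤ 1403 * (L / ε) := by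
    have h7 : 2 / (ε / 100) * Real.log (N / (ε / 100)) ≤ 2 / (ε / 100) * (7 * L) :=
      mul_le_mul_of_nonneg_left h3 (by positivity)
    rw [show 2 / (ε / 100) * (7 * L) = 1400 * (L / ε) by field_simp; norm_num] at h7
    linarith
  calc 10 * b ≤ 25000 * (L / ε) := by
        have : 0 ≤ L / ε := by positivity
        linarith
    _ = ε / 100 * (2500000 * (L / ε ^ 2)) := by field_simp; norm_num
    _ ≤ _ := by gcongr

/-! ### Soundness of the whole algorithm -/

namespace PCondAlg

variable {N : ℕ}

theorem err_zero_true {α : Type} {D : Fin 2 → PMF (Fin N)} (A : PCondAlg N α) :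
    err D 0 (fun _ => True) A = 0 := by
  unfold err
  simp only [if_true]
  exact expect_const A

/-- One good representative suffices: each earlier test either rejects or fails, both of which are
successes here, or passes control on. -/
theorem err_testRepresentatives_reject_le {c : SampleConstants} {D : Fin 2 → PMF (Fin N)} {ε : ℝ}
    {t : ℕ} {e : ℝ} (he : 0 ≤ e) (R : List (Fin N))
    (h : ∃ r ∈ R, err D 0 (fun a => a = Verdict.reject) (testRepresentative c ε t r) ≤ e) :
    err D 0 (fun a => a = Verdict.reject) (testRepresentatives c ε t R) ≤ e := by
  induction R with
  | nil => simp at h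
  | cons r R ih =>
    rw [testRepresentatives]
    by_cases hr : err D 0 (fun a => a = Verdict.reject) (testRepresentative c ε t r) ≤ e
    · rw [← add_zero e]
      refine err_bind_le zero_le_one (post_true _ _) hr le_rfl fun a _ ha => ?_
      subst ha
      exact (err_pure_of (P := fun a => a = Verdict.reject) rfl).le
    · have h' : ∃ r ∈ R, err D 0 (fun a => a = Verdict.reject)
          (testRepresentative c ε t r) ≤ e := by
        obtain ⟨r', hr', hle⟩ := h
        rcases List.mem_cons.1 hr' with rfl | hmem
        · exact absurd hle hr
        · exact ⟨r', hmem, hle⟩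
      rw [← zero_add e]
      refine err_bind_le zero_le_one (post_true _ _) (err_zero_true _).le he fun a _ _ => ?_
      cases a with
      | accept => exact ih h'
      | reject => exact (err_pure_of (P := fun a => a = Verdict.reject) rfl).trans_le he

theorem err_pcondTestEqualityUnknown_far_le {c : SampleConstants} (hc : c.cmp = 10 ^ 6)
    (hc' : c.nbh = 10 ^ 4) (hrep : c.rep = 10 ^ 7) (hfst : c.fst = 10 ^ 3)
    (hsnd : c.snd = 10 ^ 13) (hN : 0 < N) {D₁ D₂ : PMF (Fin N)} {ε : ℝ} (hε : 0 < ε) (hε1 : ε ≤ 1)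
    (hd : ε ≤ pmfTVDist D₁ D₂) :
    err ![D₁, D₂] 0 (fun a => a = Verdict.reject) (pcondTestEqualityUnknown c N ε) ≤ 1 / 3 := by
  obtain ⟨b, hb0, hb1, hb2⟩ := exists_bucket_number hN (x := ε / 100) (by positivity)
    (by linarith)
  have hbt := bucket_number_le_repSize hrep hN hε hε1 hb2
  have ht := (le_repSize hrep hN hε hε1).2
  obtain ⟨B, hB1, hB2, hB3⟩ := exists_deficit_bucket (D₁ := D₁) (D₂ := D₂) hN
    (by positivity : 0 < ε / 100) hb1 (by linarith)
  unfold pcondTestEqualityUnknown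
  set t := repSize c N ε
  have ht' : (2 : ℝ) ≤ t := by exact_mod_cast ht
  have hb0' : (1 : ℝ) ≤ b := by exact_mod_cast hb0
  obtain ⟨x, hx⟩ : ∃ x, x = ε / 100 := ⟨_, rfl⟩
  rw [← hx] at hbt hB2 hB3
  have hx0 : 0 < x := by rw [hx]; positivity
  have hx1 : x ≤ 1 / 100 := by linarith
  have hBm : 48 * x / b ≤ pmfMass D₁ B := hB3.trans (pmfMass_mono fun i hi => hi.1)
  have htb : 10 ≤ x * t / b := by
    rw [le_div_iff₀ (by positivity)]
    exact hbt
  refine le_trans ?_ (by norm_num : (1 / 2 : ℝ) * (1 / 5) + 1 / 10 ≤ 1 / 3)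
  -- The threshold 47x/b is strictly below the mass 48x/b of the bucket, so the first alternative of
  -- the hitting event is impossible and R meets B.
  refine err_bind_le zero_le_one (post_true _ _)
    ((err_hit_le (D := ![D₁, D₂]) 0 B (τ := 47 * x / b) t).trans ?_) (by norm_num)
    fun R _ hR => ?_
  · refine two_mul_exp_neg_le (by norm_num) (by norm_num) ?_
    have h1 : Real.log (1 / (1 / 2 * (1 / 5))) ≤ 5 := by
      rw [Real.log_le_iff_le_exp (by norm_num)]
      have h3 : (2.7 : ℝ) ^ 5 ≤ Real.exp 1 ^ 5 := by
        gcongr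
        linarith [Real.exp_one_gt_d9]
      rw [← Real.exp_nat_mul] at h3
      norm_num at h3 ⊢
      linarith
    have h2 : t * (47 * x / b) / 32 = 47 / 32 * (x * t / b) := by ring
    rw [h2]
    linarith
  · obtain ⟨r, hr, hrB⟩ := hR.resolve_left (not_le.2 (lt_of_lt_of_le (by gcongr; norm_num) hBm))
    refine err_testRepresentatives_reject_le (by norm_num) R ⟨r, hr, ?_⟩
    have hp : 48 * x / b ≤ pmfMass D₁ (NearWeight x D₁ r) :=
      hBm.trans (pmfMass_mono fun i hi => hB2 r i hrB hi)
    have hε2 : ε = 100 * x := by linarith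
    -- The value τ = x · 48x/b is a fraction x of a lower bound for the mass of the neighborhood,
    -- and it is strictly below the deficit mass. The samples still resolve it because x t / b ≥ 10.
    refine err_testRepresentative_far_le hc hc' (by rw [hfst]; norm_num) hsnd (hB1 r hrB) hε hε1 ht
      (τ := x * (48 * x / b)) ?_ ?_ (by positivity) ?_ ?_ ?_
    · rw [hfst, hε2]
      calc (320 : ℝ) ≤ 480 * 10 := by norm_num
        _ ≤ 4.8 * 100 * (x * t / b) := by linarith
        _ ≤ 4.8 * (1 / x) * (x * t / b) := by
          gcongr
          rw [le_div_iff₀ hx0]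
          linarith
        _ = _ := by field_simp; norm_num
    · rw [hsnd, hε2]
      have hl : 1 / 2 ≤ Real.log t := by
        linarith [Real.log_two_gt_d9, Real.log_le_log (by norm_num) ht']
      calc (320 : ℝ) ≤ 48 * 10 ^ 7 * (1 / 2) * 1 * 1 * 10 := by norm_num
        _ ≤ 48 * 10 ^ 7 * Real.log t * (1 / x) * (1 / x) * (x * t / b) := by
          have h1 : 1 ≤ 1 / x := by
            rw [le_div_iff₀ hx0]
            linarith
          gcongr
        _ = _ := by field_simp; norm_num
    · rw [← hx]
      refine le_trans ?_ hp
      rw [le_div_iff₀ (by positivity)]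
      have h1 : (b : ℝ) ≤ t := by nlinarith
      calc 10 * (x / (2 * t)) * b ≤ 10 * (x / (2 * t)) * t := by gcongr
        _ = 5 * x := by field_simp; norm_num
        _ ≤ 48 * x := by linarith
    · rw [← hx]
      exact mul_le_mul_of_nonneg_left hp hx0.le
    · rw [← hx]
      refine lt_of_lt_of_le ?_ (hB3.trans (pmfMass_mono fun i hi => ⟨hB2 r i hrB hi.1, hi.2⟩))
      have : 0 < 48 * x / b := by positivity
      nlinarith

end PCondAlg

/-! ### Worst-case number of queries -/

namespace PCondAlg

variable {N : ℕ} {α β : Type}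

theorem maxQueries_pure (a : α) : (pure a : PCondAlg N α).maxQueries = 0 := rfl

/-- The maximum ranges over all answers, even those of probability zero, so the postcondition must
hold without restricting the answers. It supplies the lengths of the sample lists. -/
theorem maxQueries_bind_le {P : α → Prop} {A : PCondAlg N α} {f : α → PCondAlg N β} {j k : ℕ}
    (hA : A.Post (fun _ _ => True) P) (hj : A.maxQueries ≤ j)
    (hf : ∀ a, P a → (f a).maxQueries ≤ k) : (A >>= f).maxQueries ≤ j + k := by
  refine le_trans ?_ (Nat.add_le_add_right hj k)
  clear hj
  induction A with
  | halt a => exact (hf a hA).trans (Nat.le_add_left _ _)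
  | query o q next ih =>
    rw [bind_query, maxQueries, maxQueries, add_assoc]
    refine Nat.add_le_add_left (Finset.sup_le fun x _ => (ih x (hA x trivial)).trans ?_) 1
    exact Nat.add_le_add_right (Finset.le_sup (f := fun x => (next x).maxQueries)
      (Finset.mem_univ x)) k
  | random m next ih =>
    rw [bind_random, maxQueries, maxQueries]
    refine Finset.sup_le fun x _ => (ih x (hA x)).trans ?_
    exact Nat.add_le_add_right (Finset.le_sup (f := fun x => (next x).maxQueries)
      (Finset.mem_univ x)) k

theorem maxQueries_bind_pure_le {A : PCondAlg N α} {g : α → β} {j : ℕ} (hj : A.maxQueries ≤ j) :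
    (A >>= fun a => pure (g a)).maxQueries ≤ j :=
  maxQueries_bind_le (k := 0) (post_true _ A) hj fun _ _ => le_rfl

theorem maxQueries_ask_le (o : Fin 2) (q : PCondQuery N) : (ask o q).maxQueries ≤ 1 := by
  rw [ask, maxQueries]
  simp [maxQueries_pure]

theorem maxQueries_random_pure (m : ℕ) :
    (random m pure : PCondAlg N (Fin (m + 1))).maxQueries ≤ 0 := by
  rw [maxQueries]
  simp [maxQueries_pure]

theorem maxQueries_replicate_ask_le (o : Fin 2) (q : PCondQuery N) (n : ℕ) :
    (replicate n (ask o q)).maxQueries ≤ n := by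
  induction n with
  | zero => exact le_rfl
  | succ n ih =>
    rw [replicate, add_comm]
    exact maxQueries_bind_le (post_true _ _) (maxQueries_ask_le o q) fun _ _ =>
      maxQueries_bind_pure_le ih

theorem maxQueries_pcondCompare_le (c : SampleConstants) (o : Fin 2) (x y : Fin N) (η K δ : ℝ) :
    (pcondCompare c o x y η K δ).maxQueries ≤ ⌈c.cmp * (K * Real.log (1 / δ) / η ^ 2)⌉₊ := by
  unfold pcondCompare
  split_ifs
  · exact Nat.zero_le _
  · exact maxQueries_bind_pure_le (maxQueries_replicate_ask_le _ _ _)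

theorem maxQueries_tabulate_le {d : α} {f : Fin N → PCondAlg N α} {k : ℕ}
    (h : ∀ y, (f y).maxQueries ≤ k) (l : List (Fin N)) :
    (tabulate d f l).maxQueries ≤ l.length * k := by
  induction l with
  | nil => exact Nat.zero_le _
  | cons y l ih =>
    rw [tabulate, List.length_cons, add_one_mul, add_comm]
    exact maxQueries_bind_le (post_true _ _) (h y) fun _ _ => maxQueries_bind_pure_le ih

theorem maxQueries_estimateNeighborhood_le (c : SampleConstants) (o : Fin 2) (x : Fin N)
    {κ β η δ : ℝ} {s m : ℕ} (hs : ⌈c.nbh * (Real.log (1 / δ) / (β * η ^ 2))⌉₊ = s)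
    (hm : ⌈c.cmp * (4 * Real.log (1 / (δ / (4 * s))) / (κ * η * β * δ / 64 / 4) ^ 2)⌉₊ = m) :
    (estimateNeighborhood c o x κ β η δ).maxQueries ≤ s + s * m := by
  unfold estimateNeighborhood
  dsimp only
  rw [hs, ← zero_add (s + s * m)]
  refine maxQueries_bind_le (post_true _ _) (maxQueries_random_pure _) fun i _ => ?_
  refine maxQueries_bind_le (post_samples _ o s) (maxQueries_replicate_ask_le _ _ _)
    fun S hS => maxQueries_bind_pure_le ?_
  refine (maxQueries_tabulate_le (fun y => (maxQueries_pcondCompare_le _ _ _ _ _ _ _).trans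
    hm.le) _).trans (Nat.mul_le_mul_right m ?_)
  exact S.dedup_sublist.length_le.trans hS.1.le

theorem maxQueries_testRepresentative_le (c : SampleConstants) {ε : ℝ} {t : ℕ} (r : Fin N)
    {s m s₁ s₂ m' : ℕ}
    (hs : ⌈c.nbh * (Real.log (1 / (1 / (100 * (t : ℝ)))) /
      (ε / 100 / (2 * t) * (ε / 100 / 8) ^ 2))⌉₊ = s)
    (hm : ⌈c.cmp * (4 * Real.log (1 / (1 / (100 * (t : ℝ)) / (4 * s))) /
      (testPrecision ε t / 4) ^ 2)⌉₊ = m)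
    (hs₁ : ⌈c.fst * (t / ε ^ 2)⌉₊ = s₁) (hs₂ : ⌈c.snd * (t * Real.log t / ε ^ 3)⌉₊ = s₂)
    (hm' : ⌈c.cmp * (4 * Real.log (1 / (1 / (200 * (t : ℝ) * (s₁ + s₂)))) /
      (testPrecision ε t / 4) ^ 2)⌉₊ = m') :
    (testRepresentative c ε t r).maxQueries ≤
      s + s * m + (s₁ + (s₂ + (s₁ + s₂) * (m' + m'))) := by
  classical
  unfold testRepresentative
  dsimp only
  rw [hs₁, hs₂]
  refine maxQueries_bind_le (post_true _ _) (maxQueries_estimateNeighborhood_le c 0 r hs hm) ?_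
  rintro ⟨w₁, α⟩ -
  dsimp only
  refine maxQueries_bind_le (post_samples _ 0 s₁) (maxQueries_replicate_ask_le _ _ _)
    fun S₁ hS₁ => ?_
  refine maxQueries_bind_le (post_samples _ 1 s₂) (maxQueries_replicate_ask_le _ _ _)
    fun S₂ hS₂ => maxQueries_bind_pure_le ?_
  refine (maxQueries_tabulate_le (k := m' + m') (fun y => maxQueries_bind_le (post_true _ _)
    ((maxQueries_pcondCompare_le _ _ _ _ _ _ _).trans hm'.le) fun _ _ => maxQueries_bind_pure_le
    ((maxQueries_pcondCompare_le _ _ _ _ _ _ _).trans hm'.le)) _).trans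
    (Nat.mul_le_mul_right _ ?_)
  rw [← hS₁.1, ← hS₂.1, ← List.length_append]
  exact (S₁ ++ S₂).dedup_sublist.length_le

theorem maxQueries_testRepresentatives_le {c : SampleConstants} {ε : ℝ} {t k : ℕ}
    (h : ∀ r : Fin N, (testRepresentative c ε t r).maxQueries ≤ k) (R : List (Fin N)) :
    (testRepresentatives c ε t R).maxQueries ≤ R.length * k := by
  induction R with
  | nil => exact Nat.zero_le _
  | cons r R ih =>
    rw [testRepresentatives, List.length_cons, add_one_mul, add_comm]
    refine maxQueries_bind_le (post_true _ _) (h r) fun a _ => ?_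
    cases a with
    | accept => exact ih
    | reject => exact Nat.zero_le _

theorem maxQueries_pcondTestEqualityUnknown_le {c : SampleConstants} {ε : ℝ} {k : ℕ}
    (h : ∀ r : Fin N, (testRepresentative c ε (repSize c N ε) r).maxQueries ≤ k) :
    (pcondTestEqualityUnknown c N ε).maxQueries ≤ repSize c N ε + repSize c N ε * k := by
  unfold pcondTestEqualityUnknown
  refine maxQueries_bind_le (post_samples _ 0 _) (maxQueries_replicate_ask_le _ _ _)
    fun R hR => (maxQueries_testRepresentatives_le h R).trans ?_
  rw [hR.1]

end PCondAlg

/-! ### Polylogarithmic bookkeeping of the query bound -/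

/-- The quantity `log N ^ 6 / ε ^ 21`, up to logarithmic factors the query complexity. -/
noncomputable def queryRate (N : ℕ) (ε : ℝ) : ℝ := Real.log N ^ 6 / ε ^ 21

/-- The logarithmic factor of the query complexity. -/
noncomputable def logFactor (N : ℕ) (ε : ℝ) : ℝ := 1 + Real.log (2 + queryRate N ε)

section rate

variable {N : ℕ} {ε : ℝ}

theorem log_natCast_ge (hN : 2 ≤ N) : 1 / 2 ≤ Real.log N := by
  have : (2 : ℝ) ≤ N := by exact_mod_cast hN
  linarith [Real.log_two_gt_d9, Real.log_le_log (by norm_num) this]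

theorem queryRate_nonneg (hε : 0 < ε) : 0 ≤ queryRate N ε := by
  unfold queryRate
  have := Real.log_natCast_nonneg N
  positivity

theorem log_two_add_queryRate_ge (hε : 0 < ε) : 1 / 2 ≤ Real.log (2 + queryRate N ε) := by
  have := queryRate_nonneg (N := N) hε
  linarith [Real.log_two_gt_d9, Real.log_le_log (x := 2) (y := 2 + queryRate N ε)
    (by norm_num) (by linarith)]

theorem one_le_logFactor (hε : 0 < ε) : 1 ≤ logFactor N ε := by
  have := log_two_add_queryRate_ge (N := N) hε
  unfold logFactor
  linarith

/-- Since log N ≥ 1/2, the rate is at least 2⁻⁶/ε, so 1/ε is at most the seventh power of 2 plus the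
rate. -/
theorem log_one_div_le (hN : 2 ≤ N) (hε : 0 < ε) (hε1 : ε ≤ 1) :
    Real.log (1 / ε) ≤ 7 * logFactor N ε := by
  have hl := log_natCast_ge hN
  have hX : 1 / ε ≤ 2 ^ 6 * queryRate N ε := by
    unfold queryRate
    have h1 : (1 / 2 : ℝ) ^ 6 ≤ Real.log N ^ 6 := by gcongr
    have h2 : ε ^ 21 ≤ ε := by
      simpa using pow_le_pow_of_le_one hε.le hε1 (by norm_num : 1 ≤ 21)
    rw [mul_div, div_le_div_iff₀ hε (by positivity)]
    nlinarith
  have hX0 := queryRate_nonneg (N := N) hε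
  have h3 : Real.log (1 / ε) ≤ Real.log ((2 + queryRate N ε) ^ 7) := by
    refine Real.log_le_log (by positivity) (hX.trans ?_)
    calc (2 : ℝ) ^ 6 * queryRate N ε ≤ (2 + queryRate N ε) ^ 6 * (2 + queryRate N ε) := by
          gcongr <;> linarith
      _ = _ := by ring
  rw [Real.log_pow] at h3
  unfold logFactor
  push_cast at h3
  linarith

theorem log_log_le (hN : 2 ≤ N) (hε : 0 < ε) (hε1 : ε ≤ 1) :
    Real.log (Real.log N) ≤ logFactor N ε := by
  have hl := log_natCast_ge hN
  have h1 : Real.log N ≤ 2 + queryRate N ε := by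
    have h2 : Real.log N ^ 6 ≤ queryRate N ε := by
      unfold queryRate
      rw [le_div_iff₀ (by positivity)]
      have : ε ^ 21 ≤ 1 := pow_le_one₀ hε.le hε1
      have h3 : 0 ≤ Real.log N ^ 6 := by positivity
      nlinarith
    rcases le_total (Real.log N) 1 with h3 | h3
    · linarith [queryRate_nonneg (N := N) hε]
    · linarith [le_self_pow₀ h3 (by norm_num : 6 ≠ 0)]
  unfold logFactor
  linarith [Real.log_le_log (by linarith) h1]

end rate

/-- `f` is nonnegative, and bounded by `log N ^ a / ε ^ b` up to logarithmic factors. -/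
def PolylogBound (a b : ℕ) (f : ℕ → ℝ → ℝ) : Prop :=
  ∃ (C : ℝ) (k : ℕ), 0 ≤ C ∧ ∀ N ε, 2 ≤ N → 0 < ε → ε ≤ 1 → 0 ≤ f N ε ∧
    f N ε ≤ C * (Real.log N ^ a * (1 / ε) ^ b) * logFactor N ε ^ k

namespace PolylogBound

variable {a b a' b' : ℕ} {f g : ℕ → ℝ → ℝ}

theorem of_le (hg : PolylogBound a b g)
    (h : ∀ N ε, 2 ≤ N → 0 < ε → ε ≤ 1 → 0 ≤ f N ε ∧ f N ε ≤ g N ε) : PolylogBound a b f := by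
  obtain ⟨C, k, hC, hg⟩ := hg
  exact ⟨C, k, hC, fun N ε hN hε hε1 => ⟨(h N ε hN hε hε1).1,
    (h N ε hN hε hε1).2.trans (hg N ε hN hε hε1).2⟩⟩

theorem congr (hg : PolylogBound a b g)
    (h : ∀ N ε, 2 ≤ N → 0 < ε → ε ≤ 1 → f N ε = g N ε) : PolylogBound a b f := by
  obtain ⟨C, k, hC, hg⟩ := hg
  exact ⟨C, k, hC, fun N ε hN hε hε1 => by rw [h N ε hN hε hε1]; exact hg N ε hN hε hε1⟩

theorem mul (hf : PolylogBound a b f) (hg : PolylogBound a' b' g) :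
    PolylogBound (a + a') (b + b') fun N ε => f N ε * g N ε := by
  obtain ⟨C, k, hC, hf⟩ := hf
  obtain ⟨C', k', hC', hg⟩ := hg
  refine ⟨C * C', k + k', by positivity, fun N ε hN hε hε1 => ?_⟩
  obtain ⟨f0, f1⟩ := hf N ε hN hε hε1
  obtain ⟨g0, g1⟩ := hg N ε hN hε hε1
  refine ⟨mul_nonneg f0 g0, (mul_le_mul f1 g1 g0 (f0.trans f1)).trans (le_of_eq ?_)⟩
  ring

theorem const {c : ℝ} (hc : 0 ≤ c) : PolylogBound 0 0 fun _ _ => c :=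
  ⟨c, 0, hc, fun N ε _ _ _ => ⟨hc, by simp⟩⟩

theorem const_mul {c : ℝ} (hc : 0 ≤ c) (hf : PolylogBound a b f) :
    PolylogBound a b fun N ε => c * f N ε := by
  simpa using (const hc).mul hf

theorem add (hf : PolylogBound a b f) (hg : PolylogBound a b g) :
    PolylogBound a b fun N ε => f N ε + g N ε := by
  obtain ⟨C, k, hC, hf⟩ := hf
  obtain ⟨C', k', hC', hg⟩ := hg
  refine ⟨C + C', k + k', by positivity, fun N ε hN hε hε1 => ?_⟩
  obtain ⟨f0, f1⟩ := hf N ε hN hε hε1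
  obtain ⟨g0, g1⟩ := hg N ε hN hε hε1
  have hl := log_natCast_ge hN
  have h1 := one_le_logFactor (N := N) hε
  refine ⟨add_nonneg f0 g0, ?_⟩
  have e1 : f N ε ≤ C * (Real.log N ^ a * (1 / ε) ^ b) * logFactor N ε ^ (k + k') :=
    f1.trans (by gcongr; exact Nat.le_add_right _ _)
  have e2 : g N ε ≤ C' * (Real.log N ^ a * (1 / ε) ^ b) * logFactor N ε ^ (k + k') :=
    g1.trans (by gcongr; exact Nat.le_add_left _ _)
  linarith

theorem weaken (hf : PolylogBound a b f) (ha : a ≤ a') (hb : b ≤ b') : PolylogBound a' b' f := by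
  obtain ⟨C, k, hC, hf⟩ := hf
  -- Only log N ≥ 1/2 is available, not log N ≥ 1, so each extra power of log N costs a factor 2.
  refine ⟨C * 2 ^ (a' - a), k, by positivity, fun N ε hN hε hε1 => ?_⟩
  obtain ⟨f0, f1⟩ := hf N ε hN hε hε1
  have hl := log_natCast_ge hN
  have h1 := one_le_logFactor (N := N) hε
  have h2 : Real.log N ^ a ≤ 2 ^ (a' - a) * Real.log N ^ a' := by
    rw [← Nat.sub_add_cancel ha, pow_add, Nat.add_sub_cancel, ← mul_assoc, ← mul_pow]
    exact le_mul_of_one_le_left (by positivity) (one_le_pow₀ (by linarith))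
  have h3 : (1 / ε) ^ b ≤ (1 / ε) ^ b' :=
    pow_le_pow_right₀ (by rw [le_div_iff₀ hε]; linarith) hb
  refine ⟨f0, f1.trans ?_⟩
  calc _ ≤ C * (2 ^ (a' - a) * Real.log N ^ a' * (1 / ε) ^ b') * logFactor N ε ^ k := by gcongr
    _ = _ := by ring

theorem natCeil (hf : PolylogBound a b f) :
    PolylogBound a b fun N ε => (⌈f N ε⌉₊ : ℝ) := by
  refine (hf.add ((const zero_le_one).weaken (Nat.zero_le a) (Nat.zero_le b))).of_le
    fun N ε hN hε hε1 => ⟨Nat.cast_nonneg _, ?_⟩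
  obtain ⟨C, k, hC, hf⟩ := hf
  exact (Nat.ceil_lt_add_one (hf N ε hN hε hε1).1).le

/-- The logarithm of a polynomial in log N and 1/ε is linear in log log N and log(1/ε), both of
which the logarithmic factor dominates; hence the exponents drop to zero. -/
theorem log (hf : PolylogBound a b f) (h : ∀ N ε, 2 ≤ N → 0 < ε → ε ≤ 1 → 1 ≤ f N ε) :
    PolylogBound 0 0 fun N ε => Real.log (f N ε) := by
  obtain ⟨C, k, hC, hf⟩ := hf
  refine ⟨Real.log (C + 1) + a + b * 7 + k, 1, ?_, fun N ε hN hε hε1 => ?_⟩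
  · have := Real.log_nonneg (by linarith : 1 ≤ C + 1)
    positivity
  have hl := log_natCast_ge hN
  have h1 := one_le_logFactor (N := N) hε
  refine ⟨Real.log_nonneg (h N ε hN hε hε1), ?_⟩
  have h2 : f N ε ≤ (C + 1) * (Real.log N ^ a * (1 / ε) ^ b) * logFactor N ε ^ k :=
    (hf N ε hN hε hε1).2.trans (by gcongr; linarith)
  have h3 := Real.log_le_log (by linarith [h N ε hN hε hε1]) h2
  have e1 : (1 / ε) ^ b ≠ 0 := by positivity
  have e2 : Real.log N ^ a ≠ 0 := by positivity
  have e3 : logFactor N ε ^ k ≠ 0 := by positivity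
  rw [Real.log_mul (by positivity) e3, Real.log_mul (by positivity) (mul_ne_zero e2 e1),
    Real.log_mul e2 e1, Real.log_pow, Real.log_pow, Real.log_pow] at h3
  have h4 : Real.log (C + 1) ≤ Real.log (C + 1) * logFactor N ε :=
    le_mul_of_one_le_right (Real.log_nonneg (by linarith)) h1
  have h5 : a * Real.log (Real.log N) ≤ a * logFactor N ε :=
    mul_le_mul_of_nonneg_left (log_log_le hN hε hε1) (Nat.cast_nonneg _)
  have h6 : b * Real.log (1 / ε) ≤ b * (7 * logFactor N ε) :=
    mul_le_mul_of_nonneg_left (log_one_div_le hN hε hε1) (Nat.cast_nonneg _)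
  have h7 : k * Real.log (logFactor N ε) ≤ k * logFactor N ε :=
    mul_le_mul_of_nonneg_left ((Real.log_le_sub_one_of_pos (by linarith)).trans (by linarith))
      (Nat.cast_nonneg _)
  simp only [pow_zero, mul_one, pow_one]
  linarith

theorem one_div_eps : PolylogBound 0 1 fun _ ε => 1 / ε :=
  ⟨1, 0, zero_le_one, fun N ε _ hε _ => ⟨by positivity, by simp⟩⟩

theorem log_div_eps : PolylogBound 1 0 fun N ε => Real.log (2 * N / ε) := by
  refine ⟨16, 1, by norm_num, fun N ε hN hε hε1 => ?_⟩
  have hN' : (2 : ℝ) ≤ N := by exact_mod_cast hN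
  have hl := log_natCast_ge hN
  have h1 := one_le_logFactor (N := N) hε
  refine ⟨Real.log_nonneg (by rw [le_div_iff₀ hε]; linarith), ?_⟩
  dsimp only
  rw [show 2 * (N : ℝ) / ε = 2 * N * (1 / ε) by ring, Real.log_mul (by positivity) (by positivity),
    Real.log_mul (by norm_num) (by positivity)]
  have h2 := Real.log_le_log (by norm_num) hN'
  have h3 := log_one_div_le hN hε hε1
  simp only [pow_one, pow_zero, mul_one]
  nlinarith

end PolylogBound

/-- The constants for which correctness and the query bound are proved. -/
noncomputable def testConstants : SampleConstants where
  cmp := 10 ^ 6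
  nbh := 10 ^ 4
  rep := 10 ^ 7
  fst := 10 ^ 3
  snd := 10 ^ 13

namespace PolylogBound

theorem repSize : PolylogBound 1 2 fun N ε => (repSize testConstants N ε : ℝ) := by
  have hlog : ∀ (N : ℕ) (ε : ℝ), 2 ≤ N → 0 < ε → ε ≤ 1 →
      1 ≤ 2 * Real.log (2 * N / ε) * (1 / ε) := by
    intro N ε hN hε hε1
    have hl := log_natCast_ge hN
    have h1 : Real.log N ≤ Real.log (2 * N / ε) := by
      refine Real.log_le_log (by positivity) ?_
      rw [le_div_iff₀ hε]
      have : (0 : ℝ) ≤ N := Nat.cast_nonneg _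
      nlinarith
    rw [mul_one_div, le_div_iff₀ hε]
    linarith
  have h := (const_mul (c := 10 ^ 7) (by norm_num)
    ((log_div_eps.mul (one_div_eps.mul one_div_eps)).mul
      (((const_mul (c := 2) (by norm_num) log_div_eps).mul one_div_eps).log hlog))).natCeil
  refine h.congr fun N ε _ _ _ => ?_
  unfold _root_.repSize testConstants
  dsimp only
  congr 3
  · congr 1
    · ring
    · congr 1
      ring

theorem maxQueries : PolylogBound 6 21 fun N ε =>
    ((pcondTestEqualityUnknown testConstants N ε).maxQueries : ℝ) := by
  have ht2 : ∀ (N : ℕ) (ε : ℝ), 2 ≤ N → 0 < ε → ε ≤ 1 →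
      (2 : ℝ) ≤ _root_.repSize testConstants N ε := fun N ε hN hε hε1 => by
    exact_mod_cast (le_repSize (c := testConstants) rfl (by omega) hε hε1).2
  set t : ℕ → ℝ → ℕ := fun N ε => _root_.repSize testConstants N ε
  have hU : PolylogBound 0 2 fun _ ε => 1 / ε * (1 / ε) := one_div_eps.mul one_div_eps
  have hT : PolylogBound 1 2 fun N ε => (t N ε : ℝ) := PolylogBound.repSize
  have hlogt : PolylogBound 0 0 fun N ε => Real.log (t N ε) :=
    hT.log fun N ε hN hε hε1 => by linarith [ht2 N ε hN hε hε1]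
  have hlogδ : PolylogBound 0 0 fun N ε => Real.log (100 * t N ε) :=
    (hT.const_mul (by norm_num)).log fun N ε hN hε hε1 => by linarith [ht2 N ε hN hε hε1]
  obtain ⟨s, hs⟩ : ∃ s : ℕ → ℝ → ℕ, ∀ N ε, s N ε = ⌈testConstants.nbh *
      (Real.log (1 / (1 / (100 * (t N ε : ℝ)))) /
        (ε / 100 / (2 * t N ε) * (ε / 100 / 8) ^ 2))⌉₊ := ⟨_, fun _ _ => rfl⟩
  have hS : PolylogBound 1 5 fun N ε => (s N ε : ℝ) := by
    refine (hlogδ.mul (((hT.mul one_div_eps).mul hU).const_mul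
      (c := 10 ^ 4 * (100 * 2 * 800 ^ 2)) (by norm_num))).natCeil.congr fun N ε hN hε hε1 => ?_
    have := ht2 N ε hN hε hε1
    rw [hs, one_div_one_div]
    congr 2
    simp only [testConstants]
    field_simp
    ring
  obtain ⟨s₁, hs₁⟩ : ∃ s₁ : ℕ → ℝ → ℕ, ∀ N ε, s₁ N ε =
      ⌈testConstants.fst * (t N ε / ε ^ 2)⌉₊ := ⟨_, fun _ _ => rfl⟩
  have hS₁ : PolylogBound 1 5 fun N ε => (s₁ N ε : ℝ) := by
    refine (((hT.mul hU).const_mul (c := 10 ^ 3) (by norm_num)).natCeil.weaken le_rfl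
      (by norm_num)).congr fun N ε hN hε hε1 => ?_
    rw [hs₁]
    congr 2
    simp only [testConstants]
    field_simp
  obtain ⟨s₂, hs₂⟩ : ∃ s₂ : ℕ → ℝ → ℕ, ∀ N ε, s₂ N ε =
      ⌈testConstants.snd * (t N ε * Real.log (t N ε) / ε ^ 3)⌉₊ := ⟨_, fun _ _ => rfl⟩
  have hS₂ : PolylogBound 1 5 fun N ε => (s₂ N ε : ℝ) := by
    refine ((((hT.mul hlogt).mul (hU.mul one_div_eps)).const_mul (c := 10 ^ 13)
      (by norm_num)).natCeil).congr fun N ε hN hε hε1 => ?_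
    rw [hs₂]
    congr 2
    simp only [testConstants]
    field_simp
  -- The precision is a constant times ε³/t², so its inverse square is of order t⁴/ε⁶; with t of
  -- type (1, 2) this has type (4, 8 + 6).
  have hθ : PolylogBound 4 14 fun N ε => 10 ^ 6 * (4 / (testPrecision ε (t N ε) / 4) ^ 2) := by
    refine ((((hT.mul hT).mul (hT.mul hT)).mul ((hU.mul hU).mul hU)).const_mul
      (c := 10 ^ 6 * (4 * 16 * (64 * 100 * 800 * 200 * 100) ^ 2)) (by norm_num)).congr
      fun N ε hN hε hε1 => ?_
    have := ht2 N ε hN hε hε1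
    simp only [testPrecision]
    field_simp
    ring
  have hpos : ∀ (N : ℕ) (ε : ℝ), 2 ≤ N → 0 < ε → ε ≤ 1 → (1 : ℝ) ≤ s N ε ∧ (1 : ℝ) ≤ s₁ N ε := by
    intro N ε hN hε hε1
    have h1 := ht2 N ε hN hε hε1
    have h2 : 0 < Real.log (100 * t N ε) := Real.log_pos (by linarith)
    constructor
    · have : 0 < s N ε := by
        rw [hs, one_div_one_div]
        exact Nat.ceil_pos.2 (by simp only [testConstants]; positivity)
      exact_mod_cast this
    · have : 0 < s₁ N ε := by
        rw [hs₁]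
        exact Nat.ceil_pos.2 (by simp only [testConstants]; positivity)
      exact_mod_cast this
  obtain ⟨m, hm⟩ : ∃ m : ℕ → ℝ → ℕ, ∀ N ε, m N ε = ⌈testConstants.cmp *
      (4 * Real.log (1 / (1 / (100 * (t N ε : ℝ)) / (4 * s N ε))) /
        (testPrecision ε (t N ε) / 4) ^ 2)⌉₊ := ⟨_, fun _ _ => rfl⟩
  have hM : PolylogBound 4 14 fun N ε => (m N ε : ℝ) := by
    refine (((((hT.mul hS).const_mul (c := 400) (by norm_num)).log
      fun N ε hN hε hε1 => ?_).mul hθ).natCeil.weaken (by norm_num) (by norm_num)).congr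
      fun N ε hN hε hε1 => ?_
    · nlinarith [ht2 N ε hN hε hε1, (hpos N ε hN hε hε1).1]
    · have h1 := ht2 N ε hN hε hε1
      have h2 := (hpos N ε hN hε hε1).1
      rw [hm, show 1 / (1 / (100 * (t N ε : ℝ)) / (4 * s N ε)) = 400 * (t N ε * s N ε) by
        field_simp; ring]
      congr 2
      simp only [testConstants]
      ring
  obtain ⟨m', hm'⟩ : ∃ m' : ℕ → ℝ → ℕ, ∀ N ε, m' N ε = ⌈testConstants.cmp *
      (4 * Real.log (1 / (1 / (200 * (t N ε : ℝ) * (s₁ N ε + s₂ N ε)))) /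
        (testPrecision ε (t N ε) / 4) ^ 2)⌉₊ := ⟨_, fun _ _ => rfl⟩
  have hM' : PolylogBound 4 14 fun N ε => (m' N ε : ℝ) := by
    refine (((((hT.mul (hS₁.add hS₂)).const_mul (c := 200) (by norm_num)).log
      fun N ε hN hε hε1 => ?_).mul hθ).natCeil.weaken (by norm_num) (by norm_num)).congr
      fun N ε hN hε hε1 => ?_
    · have : (0 : ℝ) ≤ s₂ N ε := Nat.cast_nonneg _
      nlinarith [ht2 N ε hN hε hε1, (hpos N ε hN hε hε1).2]
    · rw [hm', one_div_one_div, mul_assoc (200 : ℝ)]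
      congr 2
      simp only [testConstants]
      ring
  -- The dominant terms multiply a sample size of type (1, 5) by a comparison cost of type (4, 14).
  -- The factor t of type (1, 2) then leads to (6, 21).
  have hK : PolylogBound 5 19 fun N ε => (s N ε + s N ε * m N ε +
      (s₁ N ε + (s₂ N ε + (s₁ N ε + s₂ N ε) * (m' N ε + m' N ε))) : ℝ) := by
    have hw : ∀ {f : ℕ → ℝ → ℝ}, PolylogBound 1 5 f → PolylogBound 5 19 f := fun h =>
      h.weaken (by norm_num) (by norm_num)
    exact ((hw hS).add (hS.mul hM)).add
      ((hw hS₁).add ((hw hS₂).add ((hS₁.add hS₂).mul (hM'.add hM'))))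
  refine ((hT.weaken (by norm_num) (by norm_num)).add (hT.mul hK)).of_le
    fun N ε hN hε hε1 => ⟨Nat.cast_nonneg _, ?_⟩
  have h := PCondAlg.maxQueries_pcondTestEqualityUnknown_le (N := N) (ε := ε) fun r =>
    PCondAlg.maxQueries_testRepresentative_le testConstants (t := t N ε) r (hs N ε).symm
      (hm N ε).symm (hs₁ N ε).symm (hs₂ N ε).symm (hm' N ε).symm
  exact_mod_cast h

theorem le_rate {f : ℕ → ℝ → ℝ} (hf : PolylogBound 6 21 f) :
    ∃ (C : ℝ) (k : ℕ), ∀ (N : ℕ) (ε : ℝ), 2 ≤ N → 0 < ε → ε ≤ 1 →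
      f N ε ≤ C * (Real.log N ^ 6 / ε ^ 21) * Real.log (2 + Real.log N ^ 6 / ε ^ 21) ^ k := by
  obtain ⟨C, k, hC, hf⟩ := hf
  -- The summand 1 in the logarithmic factor is removed using 1 ≤ 2 log(2 + rate), at the price of a
  -- factor 3 per power.
  refine ⟨C * 3 ^ k, k, fun N ε hN hε hε1 => (hf N ε hN hε hε1).2.trans ?_⟩
  have hl := log_natCast_ge hN
  have h1 := log_two_add_queryRate_ge (N := N) hε
  unfold logFactor
  unfold queryRate at *
  calc _ ≤ C * (Real.log N ^ 6 * (1 / ε) ^ 21) *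
        (3 * Real.log (2 + Real.log N ^ 6 / ε ^ 21)) ^ k := by
        gcongr
        linarith
    _ = _ := by
      rw [mul_pow, one_div, inv_pow]
      ring

end PolylogBound

theorem mainTheorem6 :
    ∃ c : SampleConstants, c.Pos ∧
      (∀ (N : ℕ) (ε : ℝ), 0 < ε → ε ≤ 1 → ∀ D₁ D₂ : PMF (Fin N),
        (D₁ = D₂ →
          2 / 3 ≤ (pcondTestEqualityUnknown c N ε).verdict D₁ D₂ Verdict.accept) ∧
        (ε ≤ pmfTVDist D₁ D₂ →
          2 / 3 ≤ (pcondTestEqualityUnknown c N ε).verdict D₁ D₂ Verdict.reject)) ∧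
      (∃ (C : ℝ) (k : ℕ), ∀ (N : ℕ) (ε : ℝ), 2 ≤ N → 0 < ε → ε ≤ 1 →
        ((pcondTestEqualityUnknown c N ε).maxQueries : ℝ) ≤
          C * (Real.log N ^ 6 / ε ^ 21) *
            Real.log (2 + Real.log N ^ 6 / ε ^ 21) ^ k) := by
  refine ⟨testConstants, by norm_num [SampleConstants.Pos, testConstants], ?_,
    PolylogBound.maxQueries.le_rate⟩
  intro N ε hε hε1 D₁ D₂
  -- There is no probability distribution on an empty domain.
  have hN : 0 < N := Fin.pos D₁.support_nonempty.some
  constructor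
  · rintro rfl
    refine PCondAlg.le_verdict_apply ?_
    rw [if_neg (by decide)]
    exact PCondAlg.err_pcondTestEqualityUnknown_same_le rfl rfl
      (by norm_num [testConstants]) rfl D₁ hε hε1 (le_repSize rfl hN hε hε1).2
  · intro hd
    refine PCondAlg.le_verdict_apply ?_
    rw [if_pos rfl]
    exact PCondAlg.err_pcondTestEqualityUnknown_far_le rfl rfl rfl rfl rfl hN hε hε1 hd
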